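/- Let $\Gamma$ be a cocompact discrete subgroup of the isometry group $\mathrm{Isom}(\mathbb{H}^2)\cong\mathrm{PGL}(2,\mathbb{R})$ of the hyperbolic plane (orientation-reversing isometries are allowed), acting on the circle at infinity $S^1=\partial\mathbb{H}^2$. Let $I\subset S^1$ be a proper closed interval and $T\subset\Gamma$ a finite subset such that 1. $\gamma I\subsetneq I$ for all $\gamma\in T$; 2. if $\gamma$ is an element of $T$ or a product of two elements of $T$, and $\gamma$ fixes an endpoint $x\in\partial I$, then $\gamma$ is hyperbolic and $x$ is its attracting fixed point; 3. $\bigcup_{\gamma\in T}\gamma I=I$. Let $\rho\colon\Gamma\to\mathrm{SL}(3,\mathbb{R})$ be a representation, and let $A\subset\mathbb{R}\mathrm{P}^2$ be a closed set with non-empty interior $A^\circ$ which is contained in an affine chart (the complement of a projective line). Assume that there are an integer $N\ge 1$ and an element $\overline t\in T$ such that 1. $\rho(t)A\subset A$ for all $t\in T$; 2. $\rho(t_1)\cdots\rho(t_N)A\subset A^\circ$ whenever $t_1,\dots,t_N\in T$ and $t_N\neq\overline t$; 3. the intersection $\bigcap_{i\in\mathbb{N}}\rho(\overline t^{\,i})A$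 is a single point. Then there exists a continuous map $\xi\colon S^1\to\mathbb{R}\mathrm{P}^2$ which is $\rho$-equivariant, i.e. $\xi(\gamma x)=\rho(\gamma)\xi(x)$ for all $\gamma\in\Gamma$ and $x\in S^1$, and which satisfies $\xi(I)\subset A$. -/

import Mathlib

open Filter Topology Set
open scoped MatrixGroups Pointwise LinearAlgebra.Projectivization UpperHalfPlane

/-- The quotient topology on the projective space `ℙ K V = (V ∖ {0}) / Kˣ`. -/
instance Projectivization.quotientTopology {K V : Type*} [DivisionRing K] [AddCommGroup V]
    [Module K V] [TopologicalSpace V] : TopologicalSpace (ℙ K V) :=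
  TopologicalSpace.coinduced (Projectivization.mk' K : {v : V // v ≠ 0} → ℙ K V) inferInstance

/-- The quotient topology on `PGL(2, ℝ) = GL(2, ℝ) / ℝˣ`. -/
instance PGL2.quotientTopology : TopologicalSpace PGL(2, ℝ) :=
  TopologicalSpace.coinduced (Matrix.ProjGenLinGroup.mk : GL (Fin 2) ℝ → PGL(2, ℝ)) inferInstance

/-- The circle at infinity `S¹ = ∂ℍ` of the hyperbolic plane, as the real projective line:
in the upper half-plane model the ideal point `x : ℝ` is `[x : 1]` and `∞` is `[1 : 0]`.
The isometry group of `ℍ` is `PGL(2, ℝ)`, matrices of negative determinant acting on `ℍ` by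
`z ↦ (a z̄ + b) / (c z̄ + d)`; its action on `ℍ` extends to `∂ℍ` as the projective action. -/
abbrev IdealCircle : Type := ℙ ℝ (Fin 2 → ℝ)

/-- The real projective plane. -/
abbrev RP2 : Type := ℙ ℝ (Fin 3 → ℝ)

/-- A cocompact discrete subgroup of the isometry group `PGL(2, ℝ)` of the hyperbolic plane
(orientation-reversing isometries allowed). -/
structure IsCocompactFuchsian (Γ : Subgroup PGL(2, ℝ)) : Prop where
  discrete : DiscreteTopology Γ
  cocompact : CompactSpace (MulAction.orbitRel.Quotient Γ ℍ)

/-- A proper closed interval (arc) of the circle; its endpoints are the points of `frontier I`. -/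
structure IsProperClosedInterval (I : Set IdealCircle) : Prop where
  isClosed : IsClosed I
  isConnected : IsConnected I
  ne_univ : I ≠ univ

/-- Hyperbolic isometries of `ℍ`: the matrices representing `g` have two real eigenvalues with
different absolute values, i.e. `g` is a translation along a geodesic, possibly composed with the
reflection in that geodesic. Positive discriminant alone would also admit reflections, which are
the elements with discriminant positive and trace zero. -/
def IsHyperbolicIsometry (g : PGL(2, ℝ)) : Prop :=
  ∃ M : GL (Fin 2) ℝ, Matrix.ProjGenLinGroup.mk M = g ∧ M.IsHyperbolic ∧ M.val.trace ≠ 0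

/-- `x` is fixed by `g`, and nearby points converge to `x` under the iteration of `g`. -/
def IsAttractingFixedPoint (g : PGL(2, ℝ)) (x : IdealCircle) : Prop :=
  g • x = x ∧ ∀ᶠ z in 𝓝 x, Tendsto (fun n : ℕ => g ^ n • z) atTop (𝓝 x)

/-- The axioms on a proper closed interval `I` and a finite subset `T` of `Γ`. -/
structure IsNestingSystem (Γ : Subgroup PGL(2, ℝ)) (I : Set IdealCircle) (T : Set Γ) : Prop where
  interval : IsProperClosedInterval I
  finite : T.Finite
  ssubset : ∀ γ ∈ T, γ • I ⊂ I
  attracting : ∀ γ ∈ T ∪ T * T, ∀ x ∈ frontier I, γ • x = x →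
    IsHyperbolicIsometry (γ : PGL(2, ℝ)) ∧ IsAttractingFixedPoint (γ : PGL(2, ℝ)) x
  cover : ⋃ γ ∈ T, γ • I = I

/-- `A` is contained in an affine chart, i.e. it misses some projective line `[ker f]`. -/
def InAffineChart (A : Set RP2) : Prop :=
  ∃ f : Module.Dual ℝ (Fin 3 → ℝ), f ≠ 0 ∧ ∀ p ∈ A, f p.rep ≠ 0

/-! Since the sets tI cover I, every x in I has a coding: letters t₀, t₁, … in T with x in t₀⋯tₙ₋₁I
for all n. The same word gives nested sets ρ(t₀⋯tₙ₋₁)A in the projective plane, and ξ(x) is to be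
their common point. Four facts make this work.

The nested sets meet in one point (`ContractingSystem.exists_iInter_eq_singleton`). If the word ends
in a constant tail of tbar, this is a translate of the hypothesis on tbar. Otherwise the word splits
into infinitely many blocks, almost arbitrary in length, each mapping A into one fixed compact
subset K of the interior. A generalised Hilbert distance, built from the linear functionals without
zeros on the cone over A, is then contracted (`eq_of_backward_orbits`); no convexity of A is needed.

The point does not depend on the coding and is equivariant on I (`smul_codedPoint_eq_of_codes`). The
endpoint conditions allow I to be enlarged to an open set that T still maps into itself
(`IsNestingSystem.exists_enlargement`), so the inverse prefixes keep x at a definite angle from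
every point outside the enlargement: they approach x conically. If t codes x and s codes γx,
comparing the two sequences at equal scales and using discreteness yields arbitrarily long prefixes
p of t and q of s with q⁻¹γp in a finite set (`IsNestingSystem.exists_shadowing`). A normalised
limit of the matrices ρ(q) has rank one and an image that right multiplication by a fixed invertible
matrix does not change, so ρ(γ) matches the two coded points.

The coded point depends continuously on the word, and compactness of the set of pairs (coding,
point) passes continuity down to I.

Every orbit on the circle meets the interior of I (`IsNestingSystem.exists_smul_mem_interior`), so ξ
extends from I by equivariance. -/

/-! ### Topology of real projective spaces -/

section ProjectiveTopology

variable {ι : Type*}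

namespace Projectivization

theorem continuous_mk' {V : Type*} [AddCommGroup V] [Module ℝ V] [TopologicalSpace V] :
    Continuous (mk' ℝ : {v : V // v ≠ 0} → ℙ ℝ V) :=
  continuous_coinduced_rng

theorem continuous_iff_comp_mk' {V X : Type*} [AddCommGroup V] [Module ℝ V] [TopologicalSpace V]
    [TopologicalSpace X] {f : ℙ ℝ V → X} : Continuous f ↔ Continuous (f ∘ mk' ℝ) :=
  continuous_coinduced_dom

theorem tendsto_mk {V α : Type*} [AddCommGroup V] [Module ℝ V] [TopologicalSpace V]
    {l : Filter α} {v : α → V} (hv : ∀ a, v a ≠ 0) {w : V} (hw : w ≠ 0)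
    (h : Tendsto v l (𝓝 w)) : Tendsto (fun a => mk ℝ (v a) (hv a)) l (𝓝 (mk ℝ w hw)) := by
  have h1 : Tendsto (fun a => (⟨v a, hv a⟩ : {v : V // v ≠ 0})) l (𝓝 ⟨w, hw⟩) :=
    tendsto_subtype_rng.2 h
  exact (continuous_mk'.tendsto _).comp h1

/-- The orthogonal projection onto the line `p`, as a matrix. -/
noncomputable def lineProj [Fintype ι] (p : ℙ ℝ (ι → ℝ)) : ι → ι → ℝ :=
  Projectivization.lift (fun (v : {v : ι → ℝ // v ≠ 0}) i j => v.1 i * v.1 j / ∑ k, v.1 k * v.1 k) (by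
    rintro ⟨a, ha⟩ ⟨b, hb⟩ t rfl
    have ht : t ≠ 0 := by rintro rfl; simp at ha
    funext i j
    have : ∑ k, (t • b) k * (t • b) k = t ^ 2 * ∑ k, b k * b k := by
      rw [Finset.mul_sum]; refine Finset.sum_congr rfl fun k _ => ?_
      simp; ring
    simp only [this]
    simp only [Pi.smul_apply, smul_eq_mul]
    rw [show t * b i * (t * b j) = t ^ 2 * (b i * b j) by ring, mul_div_mul_left _ _ (by positivity)]) p

theorem sum_mul_self_pos [Fintype ι] {v : ι → ℝ} (hv : v ≠ 0) : 0 < ∑ k, v k * v k := by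
  obtain ⟨i, hi⟩ := Function.ne_iff.1 hv
  exact Finset.sum_pos' (fun k _ => mul_self_nonneg _) ⟨i, Finset.mem_univ _, mul_self_pos.2 hi⟩

theorem continuous_lineProj [Fintype ι] : Continuous (lineProj : ℙ ℝ (ι → ℝ) → ι → ι → ℝ) := by
  rw [continuous_iff_comp_mk']
  refine continuous_pi fun i => continuous_pi fun j => ?_
  change Continuous fun v : {v : ι → ℝ // v ≠ 0} => v.1 i * v.1 j / ∑ k, v.1 k * v.1 k
  have hc : ∀ k, Continuous fun v : {v : ι → ℝ // v ≠ 0} => v.1 k := fun k =>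
    (continuous_apply k).comp continuous_subtype_val
  exact ((hc i).mul (hc j)).div (continuous_finsetSum _ fun k _ => (hc k).mul (hc k))
    fun v => (sum_mul_self_pos v.2).ne'

theorem lineProj_injective [Fintype ι] :
    Function.Injective (lineProj : ℙ ℝ (ι → ℝ) → ι → ι → ℝ) := by
  intro p q h
  induction p with | h v hv =>
  induction q with | h w hw =>
  have h' : ∀ i j, v i * v j / ∑ k, v k * v k = w i * w j / ∑ k, w k * w k := fun i j =>
    congrFun (congrFun h i) j
  have hv0 := sum_mul_self_pos hv
  have hw0 := sum_mul_self_pos hw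
  obtain ⟨j, hj⟩ := Function.ne_iff.1 hv
  simp only [Pi.zero_apply] at hj
  rw [mk_eq_mk_iff']
  refine ⟨(w j * (∑ k, v k * v k)) / ((∑ k, w k * w k) * v j), ?_⟩
  funext i
  have := h' i j
  simp only [Pi.smul_apply, smul_eq_mul]
  generalize ∑ k, v k * v k = a at *
  generalize ∑ k, w k * w k = b at *
  field_simp at this ⊢
  linarith

/-- A line is determined by its orthogonal projection, so the space injects continuously into
matrices. -/
instance t2Space [Fintype ι] : T2Space (ℙ ℝ (ι → ℝ)) :=
  T2Space.of_injective_continuous lineProj_injective continuous_lineProj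

instance compactSpace [Fintype ι] : CompactSpace (ℙ ℝ (ι → ℝ)) := by
  let f : Metric.sphere (0 : ι → ℝ) 1 → ℙ ℝ (ι → ℝ) := fun v =>
    mk' ℝ ⟨v.1, by rintro h; have := v.2; rw [h] at this; simp at this⟩
  have hf : Continuous f := continuous_mk'.comp (by fun_prop)
  have hs : Function.Surjective f := by
    intro p
    induction p with | h v hv =>
    have hn : ‖v‖ ≠ 0 := norm_ne_zero_iff.2 hv
    refine ⟨⟨‖v‖⁻¹ • v, by simp [norm_smul, hn]⟩, ?_⟩
    change mk ℝ _ _ = _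
    rw [mk_eq_mk_iff']
    exact ⟨‖v‖⁻¹, rfl⟩
  exact hs.compactSpace hf

theorem continuous_smul_of_continuous {G V : Type*} [AddCommGroup V] [Module ℝ V]
    [TopologicalSpace V] [Group G] [DistribMulAction G V] [SMulCommClass G ℝ V] (g : G)
    (hg : Continuous fun v : V => g • v) : Continuous fun p : ℙ ℝ V => g • p := by
  rw [continuous_iff_comp_mk']
  change Continuous fun v : {v : V // v ≠ 0} =>
    mk' ℝ ⟨g • v.1, (smul_ne_zero_iff_ne g).mpr v.2⟩
  exact continuous_mk'.comp (by fun_prop)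

instance specialLinearGroup_continuousConstSMul [Fintype ι] [DecidableEq ι] :
    ContinuousConstSMul (Matrix.SpecialLinearGroup ι ℝ) (ℙ ℝ (ι → ℝ)) where
  continuous_const_smul g := continuous_smul_of_continuous g <| by
    change Continuous fun v : ι → ℝ => g.1.mulVec v
    fun_prop

instance pgl_continuousConstSMul : ContinuousConstSMul PGL(2, ℝ) IdealCircle where
  continuous_const_smul g := by
    obtain ⟨M, rfl⟩ := Matrix.ProjGenLinGroup.mk_surjective g
    refine continuous_smul_of_continuous M ?_
    change Continuous fun v : Fin 2 → ℝ => M.1.mulVec v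
    fun_prop

end Projectivization

end ProjectiveTopology

/-! ### Contraction of a generalised Hilbert distance -/

section Contraction

variable {V : Type*} [NormedAddCommGroup V] [InnerProductSpace ℝ V]

/-- The continuous functionals without zeros on `C`. -/
def zeroFree (C : Set V) : Set (V →L[ℝ] ℝ) := {f | ∀ x ∈ C, f x ≠ 0}

/-- `exp` of the generalised Hilbert distance of `x` and `y` with respect to `C` is at most `c`. -/
def HilbertClose (C : Set V) (c : ℝ) (x y : V) : Prop :=
  ∀ f ∈ zeroFree C, ∀ g ∈ zeroFree C, |f x| * |g y| ≤ c * (|f y| * |g x|)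

/-- The squared sine of the angle between `x` and `y`. -/
noncomputable def sinSq (x y : V) : ℝ := 1 - (inner ℝ x y / (‖x‖ * ‖y‖)) ^ 2

/-- `K` lies uniformly inside `C`, as seen by the functionals without zeros on `C`. -/
def UniformlyInside (C K : Set V) (r : ℝ) : Prop :=
  ∀ f ∈ zeroFree C, ∀ x ∈ K, r * (‖f‖ * ‖x‖) ≤ |f x|

/-- The component of `x / ‖x‖` orthogonal to `y`. -/
noncomputable def rejection (x y : V) : V :=
  ‖x‖⁻¹ • x - (inner ℝ x y / (‖x‖ * ‖y‖)) • (‖y‖⁻¹ • y)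

theorem inner_rejection_right {x y : V} (hy : y ≠ 0) :
    inner ℝ (rejection x y) y = 0 := by
  have hy' : ‖y‖ ≠ 0 := norm_ne_zero_iff.2 hy
  simp only [rejection, inner_sub_left, real_inner_smul_left, real_inner_self_eq_norm_sq]
  by_cases hx : ‖x‖ = 0
  · simp [hx]
  · field_simp
    ring

theorem inner_rejection_left {x y : V} (hx : x ≠ 0) (hy : y ≠ 0) :
    inner ℝ (rejection x y) x = sinSq x y * ‖x‖ := by
  have hx' : ‖x‖ ≠ 0 := norm_ne_zero_iff.2 hx
  have hy' : ‖y‖ ≠ 0 := norm_ne_zero_iff.2 hy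
  simp only [rejection, sinSq, inner_sub_left, real_inner_smul_left, real_inner_self_eq_norm_sq,
    real_inner_comm x y]
  field_simp

theorem norm_rejection_sq {x y : V} (hx : x ≠ 0) (hy : y ≠ 0) :
    ‖rejection x y‖ ^ 2 = sinSq x y := by
  have hx' : ‖x‖ ≠ 0 := norm_ne_zero_iff.2 hx
  rw [← real_inner_self_eq_norm_sq]
  calc inner ℝ (rejection x y) (rejection x y)
      = inner ℝ (rejection x y)
        (‖x‖⁻¹ • x - (inner ℝ x y / (‖x‖ * ‖y‖)) • (‖y‖⁻¹ • y)) := rfl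
    _ = sinSq x y := by
      rw [inner_sub_right, real_inner_smul_right, real_inner_smul_right, real_inner_smul_right,
        inner_rejection_right hy, inner_rejection_left hx hy]
      field_simp
      ring

theorem sinSq_nonneg {x y : V} (hx : x ≠ 0) (hy : y ≠ 0) : 0 ≤ sinSq x y := by
  rw [← norm_rejection_sq hx hy]; positivity

theorem sinSq_le_one (x y : V) : sinSq x y ≤ 1 := by
  have := sq_nonneg (inner ℝ x y / (‖x‖ * ‖y‖))
  unfold sinSq; linarith

theorem sinSq_comm (x y : V) : sinSq x y = sinSq y x := by
  simp only [sinSq, real_inner_comm x y, mul_comm ‖x‖]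

theorem exists_smul_eq_of_sinSq_eq_zero {x y : V} (hx : x ≠ 0) (hy : y ≠ 0)
    (h : sinSq x y = 0) : ∃ a : ℝ, a • y = x := by
  have hx' : ‖x‖ ≠ 0 := norm_ne_zero_iff.2 hx
  have h1 : rejection x y = 0 := by
    rw [← norm_eq_zero, ← sq_eq_zero_iff, norm_rejection_sq hx hy, h]
  refine ⟨‖x‖ * (inner ℝ x y / (‖x‖ * ‖y‖)) * ‖y‖⁻¹, ?_⟩
  have h2 := sub_eq_zero.1 h1
  calc _ = ‖x‖ • ((inner ℝ x y / (‖x‖ * ‖y‖)) • (‖y‖⁻¹ • y)) := by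
        simp only [smul_smul, mul_assoc]
    _ = x := by rw [← h2, smul_smul, mul_inv_cancel₀ hx', one_smul]

theorem HilbertClose.mono {C : Set V} {c c' : ℝ} {x y : V} (h : HilbertClose C c x y)
    (hc : c ≤ c') : HilbertClose C c' x y := fun f hf g hg =>
  (h f hf g hg).trans (by gcongr)

/-- A functional without zeros on `C` pulls back along `w` to another one. -/
theorem HilbertClose.map {C : Set V} {c : ℝ} {x y : V} (h : HilbertClose C c x y)
    {w : V →L[ℝ] V} (hw : MapsTo w C C) : HilbertClose C c (w x) (w y) := fun f hf g hg =>
  h (f.comp w) (fun _ hz => hf _ (hw hz)) (g.comp w) (fun _ hz => hg _ (hw hz))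

theorem not_hilbertClose_of_lt_one {C : Set V} (hD : (zeroFree C).Nonempty) {c : ℝ} (hc : c < 1)
    {x y : V} (hx : x ∈ C) (hy : y ∈ C) : ¬ HilbertClose C c x y := fun h => by
  obtain ⟨f, hf⟩ := hD
  have h1 := h f hf f hf
  have h2 : 0 < |f y| * |f x| := mul_pos (abs_pos.2 (hf y hy)) (abs_pos.2 (hf x hx))
  nlinarith

/-- The a priori diameter bound for `K`: numerators are bounded by operator norms, denominators by
uniform insideness. -/
theorem UniformlyInside.hilbertClose {C K : Set V} {r : ℝ} (hr : 0 < r)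
    (h : UniformlyInside C K r) {x y : V} (hx : x ∈ K) (hy : y ∈ K) :
    HilbertClose C (1 / r ^ 2) x y := fun f hf g hg => by
  have h1 := h f hf y hy
  have h2 := h g hg x hx
  have h3 : |f x| ≤ ‖f‖ * ‖x‖ := f.le_opNorm x
  have h4 : |g y| ≤ ‖g‖ * ‖y‖ := g.le_opNorm y
  have h5 : |f x| * |g y| ≤ (‖f‖ * ‖x‖) * (‖g‖ * ‖y‖) := by gcongr
  have h6 : (r * (‖f‖ * ‖y‖)) * (r * (‖g‖ * ‖x‖)) ≤ |f y| * |g x| := by gcongr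
  rw [one_div_mul_eq_div, le_div_iff₀ (by positivity)]
  nlinarith

/-- Replacing one direction in `K` by a nearby one changes `f` by at most `‖f‖` times the rejection,
which is small relative to the values of `f` on `K`, uniformly in `f`. -/
theorem UniformlyInside.hilbertClose_of_sinSq_lt {C K : Set V} {r : ℝ} (hr : 0 < r)
    (h : UniformlyInside C K r) {c : ℝ} (hc : 1 < c) :
    ∃ δ > 0, ∀ x ∈ K, ∀ y ∈ K, x ≠ 0 → y ≠ 0 → sinSq x y < δ → HilbertClose C c x y := by
  obtain ⟨η, hη, hηc⟩ : ∃ η > 0, (1 + η / r) ^ 2 ≤ c := by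
    -- This value gives equality, (1 + η / r) ^ 2 = c.
    refine ⟨r * (√c - 1), mul_pos hr (sub_pos.2 (Real.lt_sqrt_of_sq_lt (by simpa))), ?_⟩
    rw [mul_div_cancel_left₀ _ hr.ne', add_sub_cancel, Real.sq_sqrt (by linarith)]
  have key : ∀ x ∈ K, ∀ y ∈ K, x ≠ 0 → y ≠ 0 → sinSq x y < η ^ 2 → ∀ f ∈ zeroFree C,
      |f x| / ‖x‖ ≤ (1 + η / r) * (|f y| / ‖y‖) := by
    intro x hx y hy hx0 hy0 hs f hf
    have hx' : 0 < ‖x‖ := norm_pos_iff.2 hx0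
    have hy' : 0 < ‖y‖ := norm_pos_iff.2 hy0
    have h1 : ‖rejection x y‖ ≤ η := by
      rw [← norm_rejection_sq hx0 hy0] at hs
      exact (lt_of_pow_lt_pow_left₀ 2 hη.le hs).le
    set q := inner ℝ x y / (‖x‖ * ‖y‖) with hq
    have hq1 : |q| ≤ 1 := abs_real_inner_div_norm_mul_norm_le_one x y
    have h2 : ‖x‖⁻¹ • x = rejection x y + q • (‖y‖⁻¹ • y) := by simp [rejection, hq]
    have h3 : ‖x‖⁻¹ * f x = f (rejection x y) + q * (‖y‖⁻¹ * f y) := by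
      simpa using congrArg f h2
    have h4 : |f (rejection x y)| ≤ ‖f‖ * η := (f.le_opNorm _).trans (by gcongr)
    have h5 : ‖f‖ ≤ (|f y| / ‖y‖) / r := by
      rw [le_div_iff₀ hr, le_div_iff₀ hy']
      linarith [h f hf y hy]
    have h6 : |f x| / ‖x‖ = |‖x‖⁻¹ * f x| := by
      rw [abs_mul, abs_of_pos (inv_pos.2 hx'), div_eq_inv_mul]
    have h7 : |q * (‖y‖⁻¹ * f y)| ≤ |f y| / ‖y‖ := by
      rw [abs_mul, abs_mul, abs_of_pos (inv_pos.2 hy'), div_eq_inv_mul]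
      exact mul_le_of_le_one_left (by positivity) hq1
    calc |f x| / ‖x‖ ≤ ‖f‖ * η + |f y| / ‖y‖ := by
          rw [h6, h3]; exact (abs_add_le _ _).trans (add_le_add h4 h7)
      _ ≤ (|f y| / ‖y‖) / r * η + |f y| / ‖y‖ := by gcongr
      _ = _ := by ring
  refine ⟨η ^ 2, by positivity, fun x hx y hy hx0 hy0 hs f hf g hg => ?_⟩
  have h1 := key x hx y hy hx0 hy0 hs f hf
  have h2 := key y hy x hx hy0 hx0 (by rwa [sinSq_comm]) g hg
  have hx' : 0 < ‖x‖ := norm_pos_iff.2 hx0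
  have hy' : 0 < ‖y‖ := norm_pos_iff.2 hy0
  have h3 : (|f x| / ‖x‖) * (|g y| / ‖y‖) ≤
      ((1 + η / r) * (|f y| / ‖y‖)) * ((1 + η / r) * (|g x| / ‖x‖)) := by gcongr
  have h4 : |f x| * |g y| ≤ (1 + η / r) ^ 2 * (|f y| * |g x|) := by
    refine (div_le_div_iff_of_pos_right (mul_pos hx' hy')).1 ?_
    calc _ = (|f x| / ‖x‖) * (|g y| / ‖y‖) := by ring
      _ ≤ _ := h3
      _ = _ := by ring
  exact h4.trans (by gcongr)

/-- The gain comes from having more test functionals before applying `w` than after: a functional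
without zeros on `C` can be perturbed by half its margin on `K` and its pullback by `w` still has no
zeros on `C`. The perturbation is chosen to increase the value at `w x` and to leave that at `w y`
unchanged. -/
theorem UniformlyInside.hilbertClose_map {C K : Set V} {r : ℝ} (hr : 0 < r)
    (h : UniformlyInside C K r) (hK : (0 : V) ∉ K) {w : V →L[ℝ] V} (hw : MapsTo w C K) {c : ℝ}
    {x y : V} (hx : x ∈ C) (hy : y ∈ C) (hxy : HilbertClose C c x y) (hKC : K ⊆ C) :
    HilbertClose C (c / (1 + r / 2 * sinSq (w x) (w y))) (w x) (w y) := by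
  intro f hf g hg
  have hX0 : w x ≠ 0 := fun h0 => hK (h0 ▸ hw hx)
  have hY0 : w y ≠ 0 := fun h0 => hK (h0 ▸ hw hy)
  set X := w x
  set Y := w y
  have hs := sinSq_nonneg hX0 hY0
  -- σ is a sign for f X, so that the perturbation adds to the absolute value.
  obtain ⟨σ, hσ, hσf⟩ : ∃ σ : ℝ, |σ| = 1 ∧ ∀ b, 0 ≤ b → |f X + σ * b| = |f X| + b := by
    rcases le_total 0 (f X) with h0 | h0
    · exact ⟨1, by simp, fun b hb => by rw [abs_of_nonneg h0, abs_of_nonneg] <;> linarith⟩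
    · refine ⟨-1, by simp, fun b hb => ?_⟩
      rw [abs_of_nonpos h0, abs_of_nonpos] <;> linarith
  set u := rejection X Y
  have hu : ‖u‖ ≤ 1 := by
    have := norm_rejection_sq hX0 hY0
    have h1 := sinSq_le_one X Y
    nlinarith [norm_nonneg u]
  let f₀ : V →L[ℝ] ℝ := f + (σ * (r / 2 * ‖f‖)) • innerSL ℝ u
  have hf₀ : ∀ z, f₀ z = f z + σ * (r / 2 * ‖f‖ * inner ℝ u z) := fun z => by
    simp [f₀]; ring
  have hf₀D : f₀.comp w ∈ zeroFree C := by
    intro z hz h0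
    have hz' := hw hz
    have h1 := h f hf _ hz'
    have hwz : 0 < ‖w z‖ := norm_pos_iff.2 fun h0 => hK (h0 ▸ hz')
    have hfz : 0 < |f (w z)| := abs_pos.2 (hf _ (hKC hz'))
    have h2 : f (w z) = -(σ * (r / 2 * ‖f‖ * inner ℝ u (w z))) := by
      have : f₀ (w z) = 0 := h0
      rw [hf₀] at this; linarith
    have h3 : |f (w z)| ≤ r / 2 * ‖f‖ * ‖w z‖ := by
      rw [h2, abs_neg, abs_mul, hσ, one_mul, abs_mul, abs_of_nonneg (by positivity)]
      have : |inner ℝ u (w z)| ≤ ‖w z‖ := (abs_real_inner_le_norm _ _).trans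
        (mul_le_of_le_one_left (norm_nonneg _) hu)
      gcongr
    nlinarith
  have h1 := hxy _ hf₀D (g.comp w) (fun z hz => hg _ (hKC (hw hz)))
  change |f₀ X| * |g Y| ≤ c * (|f₀ Y| * |g X|) at h1
  rw [hf₀, hf₀, inner_rejection_right hY0, inner_rejection_left hX0 hY0, mul_zero, mul_zero,
    add_zero, hσf _ (by positivity)] at h1
  have h2 : |f X| ≤ ‖f‖ * ‖X‖ := f.le_opNorm X
  have h3 : |f X| * (1 + r / 2 * sinSq X Y) ≤ |f X| + r / 2 * ‖f‖ * (sinSq X Y * ‖X‖) := by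
    have := mul_le_mul_of_nonneg_left h2 (by positivity : 0 ≤ r / 2 * sinSq X Y)
    nlinarith
  rw [div_mul_eq_mul_div, le_div_iff₀ (by positivity)]
  calc |f X| * |g Y| * (1 + r / 2 * sinSq X Y) = (|f X| * (1 + r / 2 * sinSq X Y)) * |g Y| := by ring
    _ ≤ (|f X| + r / 2 * ‖f‖ * (sinSq X Y * ‖X‖)) * |g Y| := by gcongr
    _ ≤ _ := h1

/-- Two backward orbits of a sequence of uniform contractions of `C` agree up to scaling. -/
theorem exists_smul_eq_of_backward_orbits {C K : Set V} {r : ℝ} (hr : 0 < r)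
    (h : UniformlyInside C K r) (hC : (0 : V) ∉ C) (hKC : K ⊆ C) (hD : (zeroFree C).Nonempty)
    {w : ℕ → V →L[ℝ] V} (hw : ∀ k, MapsTo (w k) C K) {x y : ℕ → V} (hx : ∀ k, x k ∈ C)
    (hy : ∀ k, y k ∈ C) (hwx : ∀ k, w k (x (k + 1)) = x k) (hwy : ∀ k, w k (y (k + 1)) = y k) :
    ∃ a : ℝ, a • y 0 = x 0 := by
  have hx0 : ∀ k, x k ≠ 0 := fun k h0 => hC (h0 ▸ hx k)
  have hy0 : ∀ k, y k ≠ 0 := fun k h0 => hC (h0 ▸ hy k)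
  have hxK : ∀ k, x k ∈ K := fun k => hwx k ▸ hw k (hx _)
  have hyK : ∀ k, y k ∈ K := fun k => hwy k ▸ hw k (hy _)
  have hK0 : (0 : V) ∉ K := fun h0 => hC (hKC h0)
  have step : ∀ k c, HilbertClose C c (x (k + 1)) (y (k + 1)) →
      HilbertClose C (c / (1 + r / 2 * sinSq (x k) (y k))) (x k) (y k) := fun k c hc => by
    have := h.hilbertClose_map hr hK0 (hw k) (hx _) (hy _) hc hKC
    rwa [hwx, hwy] at this
  have descend : ∀ k c, HilbertClose C c (x (k + 1)) (y (k + 1)) →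
      HilbertClose C c (x 1) (y 1) := by
    intro k c
    induction k with
    | zero => exact id
    | succ k ih =>
      intro hc
      refine ih ?_
      have := hc.map (fun z hz => hKC (hw (k + 1) hz) : MapsTo (w (k + 1)) C C)
      rwa [hwx, hwy] at this
  -- If some later pair were at angle below δ, its small Hilbert constant c would descend to time 1,
  -- and the last step would make it less than one at time 0. So all later angles are bounded below,
  -- every step gains a fixed factor, and the a priori bound 1 / r ^ 2 is driven below one at time
  -- 1. Either way f = g gives a contradiction.
  by_contra hne
  have hs0 : 0 < sinSq (x 0) (y 0) := (sinSq_nonneg (hx0 0) (hy0 0)).lt_of_ne' fun h0 =>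
    hne (exists_smul_eq_of_sinSq_eq_zero (hx0 0) (hy0 0) h0)
  have hc0 : 1 < 1 + r / 2 * sinSq (x 0) (y 0) := by
    have : 0 < r / 2 * sinSq (x 0) (y 0) := by positivity
    linarith
  obtain ⟨c, hc1, hc2⟩ := exists_between hc0
  obtain ⟨δ, hδ, hδc⟩ := h.hilbertClose_of_sinSq_lt hr hc1
  have hδk : ∀ k, δ ≤ sinSq (x (k + 1)) (y (k + 1)) := by
    intro k
    by_contra! hlt
    refine not_hilbertClose_of_lt_one hD ?_ (hx 0) (hy 0)
      (step 0 c (descend k c (hδc _ (hxK _) _ (hyK _) (hx0 _) (hy0 _) hlt)))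
    rw [div_lt_one (by linarith)]
    exact hc2
  have hδ' : 1 < 1 + r / 2 * δ := by
    have : 0 < r / 2 * δ := by positivity
    linarith
  have far : ∀ j k c, 0 ≤ c → HilbertClose C c (x (k + j + 1)) (y (k + j + 1)) →
      HilbertClose C (c / (1 + r / 2 * δ) ^ j) (x (k + 1)) (y (k + 1)) := by
    intro j
    induction j with
    | zero => intro k c _ hc; simpa using hc
    | succ j ih =>
      intro k c hc0 hc
      have h1 := ih (k + 1) c hc0 (by rwa [show k + 1 + j + 1 = k + (j + 1) + 1 by ring])
      refine (step (k + 1) _ h1).mono ?_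
      rw [pow_succ, ← div_div]
      have := hδk k
      gcongr
  obtain ⟨j, hj⟩ := pow_unbounded_of_one_lt (1 / r ^ 2) hδ'
  refine not_hilbertClose_of_lt_one hD ?_ (hx 1) (hy 1)
    (far j 0 (1 / r ^ 2) (by positivity) (h.hilbertClose hr (hxK _) (hyK _)))
  rw [div_lt_one (by positivity)]
  exact hj

/-- If `f` were too small at a unit vector of `K`, the orthogonal projection of that vector to the
kernel of `f` would lie within `r` of it, hence in `C`. Compactness of the unit vectors of `K` gives
one `r` for all. -/
theorem exists_uniformlyInside [FiniteDimensional ℝ V] {C K : Set V}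
    (hK : IsCompact (K ∩ Metric.sphere 0 1)) (hKs : ∀ x ∈ K, ∀ a : ℝ, a ≠ 0 → a • x ∈ K)
    (hKC : K ⊆ interior C) : ∃ r > 0, UniformlyInside C K r := by
  obtain ⟨r, hr, hrC⟩ := hK.exists_thickening_subset_open isOpen_interior
    (inter_subset_left.trans hKC)
  refine ⟨r, hr, fun f hf x hx => ?_⟩
  by_cases hx0 : x = 0
  · simp [hx0]
  have hxn : 0 < ‖x‖ := norm_pos_iff.2 hx0
  by_contra! hlt
  obtain ⟨a, rfl⟩ := (InnerProductSpace.toDual ℝ V).surjective f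
  rw [LinearIsometryEquiv.norm_map, InnerProductSpace.toDual_apply_apply] at hlt
  have ha : 0 < ‖a‖ := by
    by_contra! h0
    have : ‖a‖ = 0 := le_antisymm h0 (norm_nonneg _)
    rw [this] at hlt
    simp only [zero_mul, mul_zero] at hlt
    exact absurd hlt (abs_nonneg _).not_gt
  set X := ‖x‖⁻¹ • x with hX
  have hXK : X ∈ K ∩ Metric.sphere 0 1 :=
    ⟨hKs x hx _ (inv_ne_zero hxn.ne'), by simp [hX, norm_smul, hxn.ne']⟩
  set v := X - (inner ℝ a X / ‖a‖ ^ 2) • a with hv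
  have hvC : v ∈ C := by
    refine interior_subset (hrC (Metric.mem_thickening_iff.2 ⟨X, hXK, ?_⟩))
    rw [dist_eq_norm, hv, sub_sub_cancel_left, norm_neg, norm_smul, Real.norm_eq_abs, abs_div,
      abs_of_pos (by positivity : 0 < ‖a‖ ^ 2), hX, real_inner_smul_right, abs_mul,
      abs_of_pos (inv_pos.2 hxn)]
    field_simp
    linarith
  refine hf v hvC ?_
  rw [InnerProductSpace.toDual_apply_apply, hv, inner_sub_right, real_inner_smul_right _ a,
    real_inner_self_eq_norm_sq, div_mul_cancel₀ _ (by positivity), sub_self]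

end Contraction

/-! ### Cones over subsets of projective space -/

section Cone

variable {ι : Type*}

/-- The punctured cone over a subset of a projective space. -/
def coneOver (S : Set (ℙ ℝ (ι → ℝ))) : Set (ι → ℝ) :=
  {v | ∃ h : v ≠ 0, Projectivization.mk ℝ v h ∈ S}

theorem mem_coneOver_mk {S : Set (ℙ ℝ (ι → ℝ))} {v : ι → ℝ} (hv : v ≠ 0) :
    v ∈ coneOver S ↔ Projectivization.mk ℝ v hv ∈ S :=
  ⟨fun ⟨_, h⟩ => h, fun h => ⟨hv, h⟩⟩

theorem coneOver_mono {S S' : Set (ℙ ℝ (ι → ℝ))} (h : S ⊆ S') : coneOver S ⊆ coneOver S' :=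
  fun _ ⟨hv, hS⟩ => ⟨hv, h hS⟩

theorem smul_mem_coneOver {S : Set (ℙ ℝ (ι → ℝ))} {v : ι → ℝ} (hv : v ∈ coneOver S) {a : ℝ}
    (ha : a ≠ 0) : a • v ∈ coneOver S := by
  obtain ⟨h, hS⟩ := hv
  refine ⟨smul_ne_zero ha h, ?_⟩
  rwa [(Projectivization.mk_eq_mk_iff' ℝ _ _ (smul_ne_zero ha h) h).2 ⟨a, rfl⟩]

theorem isOpen_coneOver {S : Set (ℙ ℝ (ι → ℝ))} (hS : IsOpen S) : IsOpen (coneOver S) := by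
  have h1 : IsOpen (Projectivization.mk' ℝ ⁻¹' S : Set {v : ι → ℝ // v ≠ 0}) :=
    hS.preimage Projectivization.continuous_mk'
  have h2 : coneOver S = Subtype.val '' (Projectivization.mk' ℝ ⁻¹' S : Set {v : ι → ℝ // v ≠ 0}) := by
    ext v
    constructor
    · rintro ⟨h, hv⟩
      exact ⟨⟨v, h⟩, hv, rfl⟩
    · rintro ⟨⟨v, h⟩, hv, rfl⟩
      exact ⟨h, hv⟩
  rw [h2]
  exact (isOpen_ne (x := (0 : ι → ℝ))).isOpenMap_subtype_val _ h1

theorem isClosed_insert_zero_coneOver {S : Set (ℙ ℝ (ι → ℝ))} (hS : IsClosed S) :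
    IsClosed (insert 0 (coneOver S)) := by
  have : insert 0 (coneOver S) = (coneOver Sᶜ)ᶜ := by
    ext v
    by_cases hv : v = 0
    · simp [hv, coneOver]
    · rw [mem_insert_iff, mem_compl_iff, mem_coneOver_mk hv, mem_coneOver_mk hv]
      simp [hv]
  rw [this]
  exact (isOpen_coneOver hS.isOpen_compl).isClosed_compl

theorem mulVec_mem_coneOver [Fintype ι] [DecidableEq ι] {S S' : Set (ℙ ℝ (ι → ℝ))}
    {g : Matrix.SpecialLinearGroup ι ℝ} (h : g • S ⊆ S') {v : ι → ℝ} (hv : v ∈ coneOver S) :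
    g.1.mulVec v ∈ coneOver S' := by
  obtain ⟨h0, hS⟩ := hv
  exact ⟨(smul_ne_zero_iff_ne g).mpr h0, h (smul_mem_smul_set hS)⟩

end Cone

/-! ### Contraction and limits of matrices on the projective plane -/

section RP2Dynamics

local notation "SL3" => Matrix.SpecialLinearGroup (Fin 3) ℝ

theorem exists_backward_orbit_lift {m : ℕ → SL3} {p : ℕ → RP2}
    (hp : ∀ k, m k • p (k + 1) = p k) : ∃ x : ℕ → Fin 3 → ℝ, ∃ hx : ∀ k, x k ≠ 0,
      (∀ k, (m k).1.mulVec (x (k + 1)) = x k) ∧ ∀ k, Projectivization.mk ℝ (x k) (hx k) = p k := by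
  let x : ℕ → Fin 3 → ℝ := fun k => Nat.rec (p 0).rep (fun k y => (m k)⁻¹ • y) k
  have hx : ∀ k, x k ≠ 0 := fun k => by
    induction k with
    | zero => exact (p 0).rep_nonzero
    | succ k ih => exact (smul_ne_zero_iff_ne (m k)⁻¹).mpr ih
  refine ⟨x, hx, fun k => smul_inv_smul (m k) (x k), fun k => ?_⟩
  induction k with
  | zero => exact (p 0).mk_rep
  | succ k ih =>
    have h1 : Projectivization.mk ℝ (x (k + 1)) (hx (k + 1)) =
        (m k)⁻¹ • Projectivization.mk ℝ (x k) (hx k) := rfl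
    rw [h1, ih, ← hp k, inv_smul_smul]

/-- The contraction argument on the punctured cones, carried to Euclidean space for its inner
product. The affine chart supplies a functional without zeros, without which Hilbert closeness would
be vacuous. -/
theorem eq_of_backward_orbits {A K : Set RP2} (hK : IsClosed K) (hKA : K ⊆ interior A)
    (hA : InAffineChart A) {m : ℕ → SL3} (hm : ∀ k, m k • A ⊆ K) {p q : ℕ → RP2}
    (hp : ∀ k, p k ∈ A) (hq : ∀ k, q k ∈ A) (hmp : ∀ k, m k • p (k + 1) = p k)
    (hmq : ∀ k, m k • q (k + 1) = q k) : p 0 = q 0 := by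
  let e : EuclideanSpace ℝ (Fin 3) ≃L[ℝ] (Fin 3 → ℝ) := EuclideanSpace.equiv (Fin 3) ℝ
  let w : ℕ → EuclideanSpace ℝ (Fin 3) →L[ℝ] EuclideanSpace ℝ (Fin 3) := fun k =>
    (e.symm : (Fin 3 → ℝ) →L[ℝ] _).comp
      ((LinearMap.toContinuousLinearMap (Matrix.mulVecLin (m k).1)).comp
        (e : EuclideanSpace ℝ (Fin 3) →L[ℝ] _))
  have hw : ∀ k v, e (w k v) = (m k).1.mulVec (e v) := fun k v => by simp [w]
  obtain ⟨x, hx0, hx, hxp⟩ := exists_backward_orbit_lift hmp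
  obtain ⟨y, hy0, hy, hyq⟩ := exists_backward_orbit_lift hmq
  have hsub : e ⁻¹' coneOver K ⊆ interior (e ⁻¹' coneOver A) := by
    refine subset_trans ?_ (interior_maximal (preimage_mono (coneOver_mono interior_subset))
      ((isOpen_coneOver isOpen_interior).preimage e.continuous))
    exact preimage_mono (coneOver_mono hKA)
  have hcomp : IsCompact (e ⁻¹' coneOver K ∩ Metric.sphere 0 1) := by
    have : e ⁻¹' coneOver K ∩ Metric.sphere 0 1 =
        Metric.sphere 0 1 ∩ e ⁻¹' insert 0 (coneOver K) := by
      ext v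
      constructor
      · exact fun ⟨h1, h2⟩ => ⟨h2, Or.inr h1⟩
      · rintro ⟨h2, h0 | h1⟩
        · have : v = 0 := e.map_eq_zero_iff.1 h0
          simp [this] at h2
        · exact ⟨h1, h2⟩
    rw [this]
    exact (isCompact_sphere _ _).inter_right
      ((isClosed_insert_zero_coneOver hK).preimage e.continuous)
  obtain ⟨r, hr, hrK⟩ := exists_uniformlyInside hcomp
    (fun v hv a ha => by
      rw [mem_preimage, map_smul]; exact smul_mem_coneOver hv ha) hsub
  have hD : (zeroFree (e ⁻¹' coneOver A)).Nonempty := by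
    obtain ⟨f, -, hf⟩ := hA
    refine ⟨(LinearMap.toContinuousLinearMap f).comp
      (e : EuclideanSpace ℝ (Fin 3) →L[ℝ] _), ?_⟩
    rintro v ⟨hv0, hv⟩ h0
    obtain ⟨a, ha⟩ := Projectivization.exists_smul_eq_mk_rep ℝ (e v) hv0
    refine hf _ hv ?_
    have h0' : f (e v) = 0 := h0
    rw [← ha, Units.smul_def, map_smul, h0', smul_zero]
  obtain ⟨a, ha⟩ := exists_smul_eq_of_backward_orbits (x := fun k => e.symm (x k))
    (y := fun k => e.symm (y k)) (w := w) hr hrK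
    (fun ⟨h, _⟩ => h (map_zero e)) (hsub.trans interior_subset) hD
    (fun k v hv => by rw [mem_preimage, hw]; exact mulVec_mem_coneOver (hm k) hv)
    (fun k => by
      rw [mem_preimage, e.apply_symm_apply, mem_coneOver_mk (hx0 k), hxp]; exact hp k)
    (fun k => by
      rw [mem_preimage, e.apply_symm_apply, mem_coneOver_mk (hy0 k), hyq]; exact hq k)
    (fun k => e.injective (by rw [hw, e.apply_symm_apply, e.apply_symm_apply, hx]))
    (fun k => e.injective (by rw [hw, e.apply_symm_apply, e.apply_symm_apply, hy]))
  rw [← hxp, ← hyq, Projectivization.mk_eq_mk_iff']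
  exact ⟨a, e.symm.injective (by rw [map_smul]; exact ha)⟩

/-- A linear map which is a limit of multiples of `M k`, all of whose orbits on a set with interior
converge to `p`, has range in the line `p`. -/
theorem limit_mem_submodule {A : Set RP2} (hA : (interior A).Nonempty)
    {M : ℕ → Matrix (Fin 3) (Fin 3) ℝ} {c : ℕ → ℝ} {L : Matrix (Fin 3) (Fin 3) ℝ}
    (hL : Tendsto (fun k => c k • M k) atTop (𝓝 L)) {p : RP2}
    (hM : ∀ v ∈ coneOver A, ∃ h : ∀ k, c k • (M k).mulVec v ≠ 0,
      Tendsto (fun k => Projectivization.mk ℝ _ (h k)) atTop (𝓝 p)) (v : Fin 3 → ℝ) :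
    L.mulVec v ∈ p.submodule := by
  -- The vectors that L sends into the line p form a subspace, and it contains the open cone over
  -- the interior of A.
  have htop : p.submodule.comap (Matrix.mulVecLin L) = ⊤ := by
    refine Submodule.eq_top_of_nonempty_interior' _ ?_
    have hne : (coneOver (interior A)).Nonempty := by
      obtain ⟨a, ha⟩ := hA
      exact ⟨a.rep, a.rep_nonzero, by rwa [a.mk_rep]⟩
    refine hne.mono (interior_maximal (fun v hv => ?_) (isOpen_coneOver isOpen_interior))
    obtain ⟨h, hlim⟩ := hM v (coneOver_mono interior_subset hv)
    change L.mulVec v ∈ p.submodule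
    by_cases h0 : L.mulVec v = 0
    · rw [h0]; exact zero_mem _
    have h1 : Tendsto (fun k => c k • (M k).mulVec v) atTop (𝓝 (L.mulVec v)) := by
      have : Continuous fun B : Matrix (Fin 3) (Fin 3) ℝ => B.mulVec v := by fun_prop
      simpa [Matrix.smul_mulVec, Function.comp_def] using (this.tendsto L).comp hL
    rw [← tendsto_nhds_unique (Projectivization.tendsto_mk h h0 h1) hlim,
      Projectivization.submodule_mk]
    exact Submodule.mem_span_singleton_self _
  have : v ∈ p.submodule.comap (Matrix.mulVecLin L) := by rw [htop]; trivial
  exact this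

-- A limit L of normalised M k is nonzero with image in the line p, and L F has image in the line q.
-- As F is invertible, L and L F have the same image.
open scoped Matrix.Norms.Elementwise in
theorem eq_of_tendsto_smul_of_tendsto_mul_smul {A : Set RP2} (hA : (interior A).Nonempty)
    {M : ℕ → SL3} {F : SL3} {p q : RP2} (hp : ∀ a ∈ A, Tendsto (fun k => M k • a) atTop (𝓝 p))
    (hq : ∀ a ∈ A, Tendsto (fun k => (M k * F) • a) atTop (𝓝 q)) : p = q := by
  have hM0 : ∀ k, (M k).1 ≠ 0 := fun k h0 => by
    have := (M k).2
    rw [h0, Matrix.det_zero] at this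
    exact zero_ne_one this
  have hc : ∀ k, ‖(M k).1‖⁻¹ ≠ 0 := fun k => inv_ne_zero (norm_ne_zero_iff.2 (hM0 k))
  obtain ⟨L, hL1, φ, hφ, hL⟩ := (isCompact_sphere (0 : Matrix (Fin 3) (Fin 3) ℝ) 1).tendsto_subseq
    (x := fun k => ‖(M k).1‖⁻¹ • (M k).1) (fun k => by
      simp [norm_smul, norm_ne_zero_iff.2 (hM0 k)])
  have hL0 : L ≠ 0 := by rintro rfl; simp at hL1
  have hLF : Tendsto (fun k => ‖(M (φ k)).1‖⁻¹ • (M (φ k) * F).1) atTop (𝓝 (L * F.1)) := by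
    have : Continuous fun B : Matrix (Fin 3) (Fin 3) ℝ => B * F.1 :=
      continuous_id.matrix_mul continuous_const
    simpa [Function.comp_def] using (this.tendsto L).comp hL
  have aux : ∀ (B : ℕ → SL3) (r : RP2), (∀ a ∈ A, Tendsto (fun k => B k • a) atTop (𝓝 r)) →
      ∀ v ∈ coneOver A, ∃ h : ∀ k, ‖(M (φ k)).1‖⁻¹ • (B (φ k)).1.mulVec v ≠ 0,
      Tendsto (fun k => Projectivization.mk ℝ _ (h k)) atTop (𝓝 r) := by
    rintro B r hB v ⟨h0, hv⟩
    have hne : ∀ k, (B (φ k)).1.mulVec v ≠ 0 := fun k => (smul_ne_zero_iff_ne (B (φ k))).mpr h0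
    refine ⟨fun k => smul_ne_zero (hc _) (hne k), ?_⟩
    refine ((hB _ hv).comp hφ.tendsto_atTop).congr fun k => ?_
    symm
    exact (Projectivization.mk_eq_mk_iff' ℝ _ _ _ (hne k)).2 ⟨_, rfl⟩
  have h1 := limit_mem_submodule hA (M := fun k => (M (φ k)).1) hL (aux M p hp)
  have h2 := limit_mem_submodule hA (M := fun k => (M (φ k) * F).1) hLF
    (aux (fun k => M k * F) q hq)
  obtain ⟨v, hv⟩ : ∃ v, L.mulVec v ≠ 0 := by
    by_contra! h
    exact hL0 (Matrix.mulVec_injective (funext fun v => by rw [h, Matrix.zero_mulVec]))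
  have h3 : L.mulVec v ∈ q.submodule := by
    have := h2 (F⁻¹ • v)
    rw [← Matrix.mulVec_mulVec] at this
    have h4 : F.1.mulVec (F⁻¹ • v) = v := smul_inv_smul F v
    rwa [h4] at this
  have line : ∀ r : RP2, L.mulVec v ∈ r.submodule → r = Projectivization.mk ℝ _ hv := by
    intro r hr
    rw [Projectivization.submodule_eq, Submodule.mem_span_singleton] at hr
    obtain ⟨a, ha⟩ := hr
    rw [← r.mk_rep]
    exact ((Projectivization.mk_eq_mk_iff' ℝ _ _ hv r.rep_nonzero).2 ⟨a, ha⟩).symm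
  rw [line p (h1 v), line q h3]

end RP2Dynamics

/-! ### Products of prefixes of a word -/

section PrefixProduct

variable {G : Type*} [Group G]

/-- The product `t 0 * ⋯ * t (n - 1)`. -/
def prefixProd (t : ℕ → G) (n : ℕ) : G := (List.ofFn fun i : Fin n => t i).prod

@[simp] theorem prefixProd_zero (t : ℕ → G) : prefixProd t 0 = 1 := by simp [prefixProd]

theorem prefixProd_succ (t : ℕ → G) (n : ℕ) : prefixProd t (n + 1) = prefixProd t n * t n := by
  rw [prefixProd, List.ofFn_succ', List.concat_eq_append, List.prod_append]
  simp [prefixProd]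

theorem prefixProd_add (t : ℕ → G) (m n : ℕ) :
    prefixProd t (m + n) = prefixProd t m * prefixProd (fun i => t (m + i)) n := by
  induction n with
  | zero => simp
  | succ n ih => rw [← add_assoc, prefixProd_succ, ih, prefixProd_succ, mul_assoc]

theorem prefixProd_congr {t s : ℕ → G} {n : ℕ} (h : ∀ i < n, t i = s i) :
    prefixProd t n = prefixProd s n := by
  unfold prefixProd
  congr 2
  funext i
  exact h i i.2

theorem prefixProd_const (g : G) (n : ℕ) : prefixProd (fun _ => g) n = g ^ n := by
  simp [prefixProd]

theorem smul_prefixProd_subset {X : Type*} [MulAction G X] {S : Set X} {t : ℕ → G}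
    (h : ∀ i, t i • S ⊆ S) (n : ℕ) : prefixProd t n • S ⊆ S := by
  induction n with
  | zero => simp
  | succ n ih =>
    rw [prefixProd_succ, mul_smul]
    exact (smul_set_mono (h n)).trans ih

theorem antitone_smul_prefixProd {X : Type*} [MulAction G X] {S : Set X} {t : ℕ → G}
    (h : ∀ i, t i • S ⊆ S) : Antitone fun n => prefixProd t n • S :=
  antitone_nat_of_succ_le fun n => by
    rw [prefixProd_succ, mul_smul]
    exact smul_set_mono (h n)

end PrefixProduct

/-! ### Points of the projective plane coded by words -/

section Coding

local notation "SL3" => Matrix.SpecialLinearGroup (Fin 3) ℝ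

/-- The contraction axioms for `ρ` on the closed set `A`. -/
structure ContractingSystem {G : Type*} [Group G] (T : Set G)
    (ρ : G →* Matrix.SpecialLinearGroup (Fin 3) ℝ) (A : Set RP2) (N : ℕ) (tbar : G) : Prop where
  finite : T.Finite
  isClosed : IsClosed A
  interior_nonempty : (interior A).Nonempty
  chart : InAffineChart A
  inv : ∀ t ∈ T, ρ t • A ⊆ A
  int : ∀ t : ℕ → G, (∀ i, t i ∈ T) → t (N - 1) ≠ tbar → ρ (prefixProd t N) • A ⊆ interior A
  point : ∃ p : RP2, ⋂ i : ℕ, ρ (tbar ^ i) • A = {p}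

variable {G : Type*} [Group G] {T : Set G} {ρ : G →* SL3} {A : Set RP2} {N : ℕ} {tbar : G}

theorem map_prefixProd_smul (t : ℕ → G) (n : ℕ) :
    ρ (prefixProd t n) = prefixProd (fun i => ρ (t i)) n := by
  simp [prefixProd, map_list_prod, List.map_ofFn, Function.comp_def]

namespace ContractingSystem

theorem smul_subset (h : ContractingSystem T ρ A N tbar) {t : ℕ → G} (ht : ∀ i, t i ∈ T) (n : ℕ) :
    ρ (prefixProd t n) • A ⊆ A := by
  rw [map_prefixProd_smul]
  exact smul_prefixProd_subset (fun i => h.inv _ (ht i)) n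

theorem antitone (h : ContractingSystem T ρ A N tbar) {t : ℕ → G} (ht : ∀ i, t i ∈ T) :
    Antitone fun n => ρ (prefixProd t n) • A := by
  simp only [map_prefixProd_smul]
  exact antitone_smul_prefixProd fun i => h.inv _ (ht i)

theorem subsingleton_of_frequently (h : ContractingSystem T ρ A N tbar) {t : ℕ → G}
    (ht : ∀ i, t i ∈ T) (hf : ∀ m, ∃ n, m ≤ n ∧ t (n + (N - 1)) ≠ tbar) :
    (⋂ n, ρ (prefixProd t n) • A).Subsingleton := by
  -- There are finitely many words of length N with last letter other than tbar, so the union K of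
  -- the images of A is closed in the interior of A.
  let F : Set G := {g | ∃ s : ℕ → G, (∀ i, s i ∈ T) ∧ s (N - 1) ≠ tbar ∧ prefixProd s N = g}
  have hF : F.Finite := by
    have h1 : (Set.pi univ fun _ : Fin N => T).Finite := Set.Finite.pi fun _ => h.finite
    refine (h1.image fun s => (List.ofFn s).prod).subset ?_
    rintro g ⟨s, hs, -, rfl⟩
    exact ⟨fun i => s i, fun i _ => hs i, rfl⟩
  let K : Set RP2 := ⋃ g ∈ F, ρ g • A
  have hK : IsClosed K := hF.isClosed_biUnion fun g _ => h.isClosed.smul (ρ g)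
  have hKA : K ⊆ interior A := iUnion₂_subset fun g ⟨s, hs, hsN, hsg⟩ =>
    hsg ▸ h.int s hs hsN
  choose f hf1 hf2 using hf
  -- The block from n k to n (k + 1) starts with a word of length N whose last letter is not tbar,
  -- hence maps A into K whatever letters follow.
  let n : ℕ → ℕ := fun k => Nat.rec (f 0) (fun _ m => f (m + N)) k
  have hn : ∀ k, n k + N ≤ n (k + 1) := fun k => hf1 _
  have hnt : ∀ k, t (n k + (N - 1)) ≠ tbar := fun k => by
    cases k with
    | zero => exact hf2 _
    | succ k => exact hf2 _
  have hm : ∀ k, ρ ((prefixProd t (n k))⁻¹ * prefixProd t (n (k + 1))) • A ⊆ K := fun k => by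
    obtain ⟨j, hj⟩ := Nat.exists_eq_add_of_le (hn k)
    rw [hj, add_assoc, prefixProd_add, inv_mul_cancel_left, prefixProd_add, map_mul, mul_smul]
    refine (smul_set_mono (h.smul_subset (fun i => ht _) j)).trans ?_
    exact subset_biUnion_of_mem (u := fun g => ρ g • A) ⟨_, fun i => ht _, hnt k, rfl⟩
  intro p hp q hq
  rw [mem_iInter] at hp hq
  have key := eq_of_backward_orbits hK hKA h.chart hm
    (p := fun k => (ρ (prefixProd t (n k)))⁻¹ • p) (q := fun k => (ρ (prefixProd t (n k)))⁻¹ • q)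
    (fun k => mem_smul_set_iff_inv_smul_mem.1 (hp _))
    (fun k => mem_smul_set_iff_inv_smul_mem.1 (hq _))
    (fun k => by simp only [map_mul, map_inv, smul_smul]; group)
    (fun k => by simp only [map_mul, map_inv, smul_smul]; group)
  exact MulAction.injective _ key

theorem exists_iInter_eq_singleton (h : ContractingSystem T ρ A N tbar) {t : ℕ → G}
    (ht : ∀ i, t i ∈ T) : ∃ p, ⋂ n, ρ (prefixProd t n) • A = {p} := by
  by_cases hf : ∀ m, ∃ n, m ≤ n ∧ t (n + (N - 1)) ≠ tbar
  · obtain ⟨p, hp⟩ := IsCompact.nonempty_iInter_of_sequence_nonempty_isCompact_isClosed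
      (fun n => ρ (prefixProd t n) • A) (fun n => h.antitone ht (Nat.le_succ n))
      (fun n => (h.interior_nonempty.mono interior_subset).smul_set)
      (h.isClosed.smul _).isCompact (fun n => h.isClosed.smul _)
    exact ⟨p, (h.subsingleton_of_frequently ht hf).eq_singleton_of_mem hp⟩
  · push Not at hf
    obtain ⟨m, hm⟩ := hf
    obtain ⟨p, hp⟩ := h.point
    refine ⟨ρ (prefixProd t (m + (N - 1))) • p, ?_⟩
    have h1 : ∀ n, prefixProd t (m + (N - 1) + n) = prefixProd t (m + (N - 1)) * tbar ^ n := by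
      intro n
      rw [prefixProd_add, ← prefixProd_const, prefixProd_congr (n := n)]
      intro i _
      have := hm (m + i) (by omega)
      rwa [show m + i + (N - 1) = m + (N - 1) + i by ring] at this
    have h2 : ⋂ n, ρ (prefixProd t n) • A = ⋂ n, ρ (prefixProd t (m + (N - 1) + n)) • A := by
      refine subset_antisymm (subset_iInter fun n => iInter_subset _ _)
        (subset_iInter fun n => (iInter_subset _ n).trans (h.antitone ht (Nat.le_add_left _ _)))
    simp only [h2, h1, map_mul, mul_smul]
    rw [← smul_set_iInter, hp, smul_set_singleton]

/-- The point of `RP²` with the coding `t`. -/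
noncomputable def codedPoint (h : ContractingSystem T ρ A N tbar) (t : ℕ → T) : RP2 :=
  (h.exists_iInter_eq_singleton fun i => (t i).2).choose

theorem iInter_eq (h : ContractingSystem T ρ A N tbar) (t : ℕ → T) :
    ⋂ n, ρ (prefixProd (fun i => (t i : G)) n) • A = {h.codedPoint t} :=
  (h.exists_iInter_eq_singleton fun i => (t i).2).choose_spec

theorem codedPoint_mem_smul (h : ContractingSystem T ρ A N tbar) (t : ℕ → T) (n : ℕ) :
    h.codedPoint t ∈ ρ (prefixProd (fun i => (t i : G)) n) • A := by
  have : h.codedPoint t ∈ ⋂ n, ρ (prefixProd (fun i => (t i : G)) n) • A := by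
    rw [h.iInter_eq]; rfl
  exact mem_iInter.1 this n

theorem codedPoint_mem (h : ContractingSystem T ρ A N tbar) (t : ℕ → T) : h.codedPoint t ∈ A := by
  simpa using h.codedPoint_mem_smul t 0

theorem exists_smul_subset (h : ContractingSystem T ρ A N tbar) (t : ℕ → T) {U : Set RP2}
    (hU : U ∈ 𝓝 (h.codedPoint t)) : ∃ n, ρ (prefixProd (fun i => (t i : G)) n) • A ⊆ U := by
  refine exists_subset_nhds_of_isCompact (h.antitone fun i => (t i).2).directed_ge
    (fun n => (h.isClosed.smul (ρ (prefixProd (fun i => (t i : G)) n))).isCompact) fun x hx => ?_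
  rw [h.iInter_eq, mem_singleton_iff] at hx
  rwa [hx]

theorem tendsto_smul (h : ContractingSystem T ρ A N tbar) (t : ℕ → T) {a : RP2} (ha : a ∈ A) :
    Tendsto (fun n => ρ (prefixProd (fun i => (t i : G)) n) • a) atTop (𝓝 (h.codedPoint t)) := by
  intro U hU
  obtain ⟨n, hn⟩ := h.exists_smul_subset t hU
  rw [Filter.mem_map]
  filter_upwards [eventually_ge_atTop n] with k hk
  exact hn (h.antitone (fun i => (t i).2) hk (smul_mem_smul_set ha))

/-- Words that share a long prefix have coded points in the same small image of `A`. -/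
theorem continuous_codedPoint [TopologicalSpace T] [DiscreteTopology T]
    (h : ContractingSystem T ρ A N tbar) : Continuous h.codedPoint := by
  refine continuous_iff_continuousAt.2 fun t U hU => ?_
  obtain ⟨n, hn⟩ := h.exists_smul_subset t hU
  rw [Filter.mem_map]
  have : {s : ℕ → T | ∀ i < n, s i = t i} ∈ 𝓝 t := by
    have : {s : ℕ → T | ∀ i < n, s i = t i} = ⋂ i ∈ Finset.range n, {s | s i = t i} := by
      ext s; simp
    rw [this, Filter.biInter_finset_mem]
    intro i _
    exact (continuous_apply i).continuousAt.preimage_mem_nhds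
      ((isOpen_discrete {t i}).mem_nhds rfl)
  filter_upwards [this] with s hs
  apply hn
  rw [← prefixProd_congr (t := fun i => (s i : G)) fun i hi => congrArg _ (hs i hi)]
  exact h.codedPoint_mem_smul s n

/-- Points whose codings shadow one another up to a finite set correspond under `ρ γ`. -/
theorem smul_codedPoint_eq (h : ContractingSystem T ρ A N tbar) {t s : ℕ → T} {γ : G} {F : Set G}
    (hF : F.Finite) {n m : ℕ → ℕ} (hn : Tendsto n atTop atTop) (hm : Tendsto m atTop atTop)
    (hF' : ∀ k, (prefixProd (fun i => (s i : G)) (m k))⁻¹ * γ *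
      prefixProd (fun i => (t i : G)) (n k) ∈ F) :
    ρ γ • h.codedPoint t = h.codedPoint s := by
  -- By pigeonhole one element f of F occurs infinitely often; along that subsequence γ times the
  -- prefix of t is the prefix of s times f.
  obtain ⟨f, -, hf⟩ : ∃ f ∈ F, ∃ᶠ k in atTop, (prefixProd (fun i => (s i : G)) (m k))⁻¹ * γ *
      prefixProd (fun i => (t i : G)) (n k) = f := by
    by_contra! hne
    have : ∀ᶠ k in atTop, ∀ f ∈ F, (prefixProd (fun i => (s i : G)) (m k))⁻¹ * γ *
      prefixProd (fun i => (t i : G)) (n k) ≠ f := by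
      rw [Filter.eventually_all_finite hF]
      exact hne
    obtain ⟨k, hk⟩ := this.exists
    exact hk _ (hF' k) rfl
  obtain ⟨φ, hφ, hφf⟩ := Filter.extraction_of_frequently_atTop hf
  refine (eq_of_tendsto_smul_of_tendsto_mul_smul h.interior_nonempty
    (M := fun k => ρ (prefixProd (fun i => (s i : G)) (m (φ k)))) (F := ρ f)
    (fun a ha => (h.tendsto_smul s ha).comp (hm.comp hφ.tendsto_atTop)) fun a ha => ?_).symm
  refine (((h.tendsto_smul t ha).comp (hn.comp hφ.tendsto_atTop)).const_smul (ρ γ)).congr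
    fun k => ?_
  simp only [Function.comp_apply, ← hφf k, ← map_mul, smul_smul]
  group

end ContractingSystem

end Coding

/-! ### The area form of the plane -/

section Area

/-- The determinant of two vectors of the plane. -/
def area (x y : Fin 2 → ℝ) : ℝ := x 0 * y 1 - x 1 * y 0

theorem area_mulVec (M : Matrix (Fin 2) (Fin 2) ℝ) (x y : Fin 2 → ℝ) :
    area (M.mulVec x) (M.mulVec y) = M.det * area x y := by
  simp only [area, Matrix.mulVec, dotProduct, Fin.sum_univ_two, Matrix.det_fin_two]
  ring

theorem area_self (x : Fin 2 → ℝ) : area x x = 0 := by simp only [area]; ring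

theorem area_comm (x y : Fin 2 → ℝ) : area x y = -area y x := by simp only [area]; ring

theorem area_smul_left (c : ℝ) (x y : Fin 2 → ℝ) : area (c • x) y = c * area x y := by
  simp only [area, Pi.smul_apply, smul_eq_mul]; ring

theorem area_smul_right (c : ℝ) (x y : Fin 2 → ℝ) : area x (c • y) = c * area x y := by
  simp only [area, Pi.smul_apply, smul_eq_mul]; ring

theorem area_add_right (x y z : Fin 2 → ℝ) : area x (y + z) = area x y + area x z := by
  simp only [area, Pi.add_apply]; ring

/-- Cramer's rule without division; it expands a vector in a basis throughout. -/
theorem area_smul_eq (x y z : Fin 2 → ℝ) : area x y • z = area z y • x + area x z • y := by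
  funext i
  fin_cases i <;> simp [area] <;> ring

theorem abs_area_le (x y : Fin 2 → ℝ) : |area x y| ≤ 2 * (‖x‖ * ‖y‖) := by
  have h1 : ∀ i, |x i| ≤ ‖x‖ := norm_le_pi_norm x
  have h2 : ∀ i, |y i| ≤ ‖y‖ := norm_le_pi_norm y
  calc |area x y| ≤ |x 0 * y 1| + |x 1 * y 0| := abs_sub _ _
    _ = |x 0| * |y 1| + |x 1| * |y 0| := by rw [abs_mul, abs_mul]
    _ ≤ ‖x‖ * ‖y‖ + ‖x‖ * ‖y‖ := by
      have := h1 0; have := h1 1; have := h2 0; have := h2 1; gcongr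
    _ = _ := by ring

theorem continuous_area_left (y : Fin 2 → ℝ) : Continuous fun x => area x y := by
  unfold area; fun_prop

theorem mk_eq_mk_iff_area {x y : Fin 2 → ℝ} (hx : x ≠ 0) (hy : y ≠ 0) :
    Projectivization.mk ℝ x hx = Projectivization.mk ℝ y hy ↔ area x y = 0 := by
  rw [Projectivization.mk_eq_mk_iff']
  constructor
  · rintro ⟨a, rfl⟩
    rw [area_smul_left, area_self, mul_zero]
  · intro h
    obtain ⟨i, hi⟩ := Function.ne_iff.1 hy
    simp only [Pi.zero_apply] at hi
    refine ⟨x i / y i, funext fun j => ?_⟩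
    simp only [area] at h
    simp only [Pi.smul_apply, smul_eq_mul]
    rw [div_mul_eq_mul_div, div_eq_iff hi]
    fin_cases i <;> fin_cases j <;> simp <;> linarith

theorem exists_area_eq_one {v : Fin 2 → ℝ} (hv : v ≠ 0) : ∃ w, area v w = 1 := by
  have h := Projectivization.sum_mul_self_pos hv
  rw [Fin.sum_univ_two] at h
  refine ⟨![-v 1 / (v 0 * v 0 + v 1 * v 1), v 0 / (v 0 * v 0 + v 1 * v 1)], ?_⟩
  simp only [area, Matrix.cons_val_zero, Matrix.cons_val_one]
  rw [← mul_div_assoc, ← mul_div_assoc, ← sub_div, div_eq_one_iff_eq h.ne']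
  ring

end Area

/-! ### Matrix lifts of determinant ±1 and discreteness -/

section Lift

/-- `M` is a matrix of determinant `±1` representing `g`. -/
def IsLift (M : Matrix (Fin 2) (Fin 2) ℝ) (g : PGL(2, ℝ)) : Prop :=
  ∃ N : GL (Fin 2) ℝ, Matrix.ProjGenLinGroup.mk N = g ∧ N.val = M ∧ |M.det| = 1

theorem exists_isLift (g : PGL(2, ℝ)) : ∃ M, IsLift M g := by
  obtain ⟨N, rfl⟩ := Matrix.ProjGenLinGroup.mk_surjective g
  have hd : 0 < |N.val.det| := abs_pos.2 ((Matrix.isUnit_iff_isUnit_det _).1 N.isUnit).ne_zero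
  let u : ℝˣ := Units.mk0 (√|N.val.det|)⁻¹ (inv_ne_zero (Real.sqrt_pos.2 hd).ne')
  refine ⟨_, N * .scalar (Fin 2) u, by simp, rfl, ?_⟩
  have : (N * Matrix.GeneralLinearGroup.scalar (Fin 2) u).val = (√|N.val.det|)⁻¹ • N.val := by
    ext i j
    simp [u, Matrix.GeneralLinearGroup.scalar, mul_comm]
  rw [this, Matrix.det_smul, abs_mul, Fintype.card_fin, inv_pow, Real.sq_sqrt hd.le,
    abs_of_pos (inv_pos.2 hd), inv_mul_cancel₀ hd.ne']

namespace IsLift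

variable {M M' : Matrix (Fin 2) (Fin 2) ℝ} {g g' : PGL(2, ℝ)}

theorem abs_det (h : IsLift M g) : |M.det| = 1 := let ⟨_, _, _, h⟩ := h; h

theorem det_ne_zero (h : IsLift M g) : M.det ≠ 0 := fun h0 => by
  have := h.abs_det
  rw [h0] at this
  simp at this

theorem det_mul_self (h : IsLift M g) : M.det * M.det = 1 := by
  rw [← abs_mul_abs_self, h.abs_det, one_mul]

theorem one : IsLift 1 1 := ⟨1, by simp, rfl, by simp⟩

theorem mul (h : IsLift M g) (h' : IsLift M' g') : IsLift (M * M') (g * g') := by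
  have h1 := h.abs_det
  have h2 := h'.abs_det
  obtain ⟨N, rfl, rfl, -⟩ := h
  obtain ⟨N', rfl, rfl, -⟩ := h'
  exact ⟨N * N', by simp, rfl, by rw [Matrix.det_mul, abs_mul, h1, h2, one_mul]⟩

theorem inv (h : IsLift M g) : IsLift M⁻¹ g⁻¹ := by
  have h1 := h.abs_det
  obtain ⟨N, rfl, rfl, -⟩ := h
  refine ⟨N⁻¹, by simp, Matrix.coe_units_inv N, ?_⟩
  rw [Matrix.det_nonsing_inv, Ring.inverse_eq_inv', abs_inv, h1, inv_one]

theorem inv_eq (h : IsLift M g) : M⁻¹ = M.det • M.adjugate := by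
  rw [Matrix.inv_def, Ring.inverse_eq_inv', ← eq_inv_of_mul_eq_one_left h.det_mul_self]

theorem mulVec_ne_zero (h : IsLift M g) {v : Fin 2 → ℝ} (hv : v ≠ 0) : M.mulVec v ≠ 0 := by
  obtain ⟨N, -, rfl, -⟩ := h
  exact (smul_ne_zero_iff_ne N).mpr hv

theorem smul_mk (h : IsLift M g) {v : Fin 2 → ℝ} (hv : v ≠ 0) :
    g • Projectivization.mk ℝ v hv = Projectivization.mk ℝ (M.mulVec v) (h.mulVec_ne_zero hv) := by
  obtain ⟨N, rfl, rfl, -⟩ := h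
  rfl

theorem inv_mulVec_mulVec (h : IsLift M g) (v : Fin 2 → ℝ) : M⁻¹.mulVec (M.mulVec v) = v := by
  rw [Matrix.mulVec_mulVec, Matrix.nonsing_inv_mul _ h.det_ne_zero.isUnit, Matrix.one_mulVec]

theorem mulVec_inv_mulVec (h : IsLift M g) (v : Fin 2 → ℝ) : M.mulVec (M⁻¹.mulVec v) = v := by
  rw [Matrix.mulVec_mulVec, Matrix.mul_nonsing_inv _ h.det_ne_zero.isUnit, Matrix.one_mulVec]

theorem abs_area_mulVec (h : IsLift M g) (x y : Fin 2 → ℝ) :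
    |area (M.mulVec x) (M.mulVec y)| = |area x y| := by
  rw [area_mulVec, abs_mul, h.abs_det, one_mul]

end IsLift

theorem abs_apply_le_norm_mulVec (M : Matrix (Fin 2) (Fin 2) ℝ) (i j : Fin 2) :
    |M i j| ≤ ‖M.mulVec (Pi.single j 1)‖ := by
  have := norm_le_pi_norm (M.mulVec (Pi.single j 1)) i
  simpa using this

/-- A discrete subgroup of `PGL(2, ℝ)` has finitely many elements of bounded norm. -/
theorem finite_bounded_lifts {Γ : Subgroup PGL(2, ℝ)} (hΓ : DiscreteTopology Γ) (R : ℝ) :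
    {γ : Γ | ∃ M, IsLift M (γ : PGL(2, ℝ)) ∧ ∀ i j, |M i j| ≤ R}.Finite := by
  by_contra hinf
  let γ := Set.Infinite.natEmbedding _ hinf
  choose M hM hMR using fun k => (γ k).2
  have hcomp : IsCompact {B : Matrix (Fin 2) (Fin 2) ℝ | ∀ i j, |B i j| ≤ R} := by
    have : {B : Matrix (Fin 2) (Fin 2) ℝ | ∀ i j, |B i j| ≤ R} =
        Set.pi univ fun _ => Set.pi univ fun _ => Icc (-R) R := by
      ext B
      exact ⟨fun h i _ j _ => abs_le.1 (h i j), fun h i j => abs_le.2 (h i trivial j trivial)⟩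
    rw [this]
    exact isCompact_univ_pi fun _ => isCompact_univ_pi fun _ => isCompact_Icc
  have : FirstCountableTopology (Matrix (Fin 2) (Fin 2) ℝ) :=
    inferInstanceAs (FirstCountableTopology (Fin 2 → Fin 2 → ℝ))
  obtain ⟨L, -, φ, hφ, hL⟩ := hcomp.tendsto_subseq hMR
  have hdet : Continuous fun B : Matrix (Fin 2) (Fin 2) ℝ => B.det := continuous_id.matrix_det
  have hLdet : |L.det| = 1 := by
    refine tendsto_nhds_unique ((hdet.abs.tendsto L).comp hL) ?_
    exact tendsto_const_nhds.congr fun k => ((hM (φ k)).abs_det).symm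
  have hLu : IsUnit L.det := isUnit_iff_ne_zero.2 fun h0 => by simp [h0] at hLdet
  -- For determinant ±1 the inverse is polynomial in the entries, so the inverses converge as well
  -- and consecutive quotients tend to 1, which discreteness forbids.
  have hinvc : Continuous fun B : Matrix (Fin 2) (Fin 2) ℝ => B.det • B.adjugate :=
    hdet.smul continuous_id.matrix_adjugate
  have hLinv : L⁻¹ = L.det • L.adjugate :=
    IsLift.inv_eq ⟨Matrix.GeneralLinearGroup.mkOfDetNeZero L hLu.ne_zero, rfl, rfl, hLdet⟩
  have hinv : Tendsto (fun k => (M (φ k))⁻¹) atTop (𝓝 L⁻¹) := by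
    rw [hLinv]
    exact ((hinvc.tendsto L).comp hL).congr fun k => ((hM (φ k)).inv_eq).symm
  have hmul : Continuous fun p : Matrix (Fin 2) (Fin 2) ℝ × Matrix (Fin 2) (Fin 2) ℝ =>
      p.1 * p.2 := continuous_fst.matrix_mul continuous_snd
  have h1 : Tendsto (fun k => (M (φ k))⁻¹ * M (φ (k + 1))) atTop (𝓝 1) := by
    have := (hmul.tendsto (L⁻¹, L)).comp (hinv.prodMk_nhds (hL.comp (tendsto_add_atTop_nat 1)))
    simpa [Function.comp_def, Matrix.nonsing_inv_mul _ hLu] using this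
  have h2 : Tendsto (fun k => (M (φ (k + 1)))⁻¹ * M (φ k)) atTop (𝓝 1) := by
    have := (hmul.tendsto (L⁻¹, L)).comp ((hinv.comp (tendsto_add_atTop_nat 1)).prodMk_nhds hL)
    simpa [Function.comp_def, Matrix.nonsing_inv_mul _ hLu] using this
  choose N hNγ hNM _ using hM
  have hN : Tendsto (fun k => (N (φ k))⁻¹ * N (φ (k + 1))) atTop (𝓝 1) := by
    rw [Units.isInducing_embedProduct.tendsto_nhds_iff]
    refine Tendsto.prodMk_nhds ?_ ?_
    · simpa [Function.comp_def, Matrix.coe_units_inv, hNM] using h1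
    · refine (MulOpposite.continuous_op.tendsto _).comp ?_
      simpa [mul_inv_rev, Matrix.coe_units_inv, hNM] using h2
  obtain ⟨U, hU, hU1⟩ := isOpen_induced_iff.1 (isOpen_discrete ({1} : Set Γ))
  have h1U : (1 : PGL(2, ℝ)) ∈ U := by
    have : (1 : Γ) ∈ Subtype.val ⁻¹' U := by rw [hU1]; rfl
    exact this
  have hV : (Matrix.ProjGenLinGroup.mk ⁻¹' U : Set (GL (Fin 2) ℝ)) ∈ 𝓝 1 :=
    (hU.preimage (continuous_coinduced_rng : Continuous
      (Matrix.ProjGenLinGroup.mk : GL (Fin 2) ℝ → PGL(2, ℝ)))).mem_nhds (by simpa using h1U)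
  obtain ⟨k, hk⟩ := (hN.eventually hV).exists
  have hk' : ((γ (φ k)).1)⁻¹ * (γ (φ (k + 1))).1 ∈ Subtype.val ⁻¹' U := by
    rw [map_mul, map_inv, hNγ, hNγ] at hk
    exact hk
  rw [hU1, mem_singleton_iff, inv_mul_eq_one] at hk'
  have := hφ.injective (γ.injective (Subtype.ext hk'))
  omega

end Lift

/-! ### Conical convergence and shadowing -/

section Conical

/-- The matrices `a n` contract `v` as strongly as possible, up to a bounded factor. -/
def ConicalAt (a : ℕ → Matrix (Fin 2) (Fin 2) ℝ) (v : Fin 2 → ℝ) : Prop :=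
  ∃ C, ∀ n w, ‖(a n).mulVec w‖ * ‖(a n).mulVec v‖ ≤ C * ‖w‖

/-- The area of `v` and `u` is preserved up to sign, so an angle bounded below between their images
bounds the product of the norms. Doing this for a basis `u`, `u'` bounds it for all vectors. -/
theorem conicalAt_of_area {a : ℕ → Matrix (Fin 2) (Fin 2) ℝ} {g : ℕ → PGL(2, ℝ)}
    (ha : ∀ n, IsLift (a n) (g n)) {v u u' : Fin 2 → ℝ} (hu : area u u' ≠ 0) {κ : ℝ} (hκ : 0 < κ)
    (h : ∀ n, κ * (‖(a n).mulVec v‖ * ‖(a n).mulVec u‖) ≤ |area ((a n).mulVec v) ((a n).mulVec u)|)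
    (h' : ∀ n, κ * (‖(a n).mulVec v‖ * ‖(a n).mulVec u'‖) ≤
      |area ((a n).mulVec v) ((a n).mulVec u')|) : ConicalAt a v := by
  have bound : ∀ n, ∀ x, κ * (‖(a n).mulVec v‖ * ‖(a n).mulVec x‖) ≤
      |area ((a n).mulVec v) ((a n).mulVec x)| →
      ‖(a n).mulVec x‖ * ‖(a n).mulVec v‖ ≤ |area v x| / κ := fun n x hx => by
    rw [(ha n).abs_area_mulVec] at hx
    rw [le_div_iff₀ hκ]
    linarith
  refine ⟨(2 * ‖u'‖ * (|area v u| / κ) + 2 * ‖u‖ * (|area v u'| / κ)) / |area u u'|,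
    fun n w => ?_⟩
  have hpos : 0 < |area u u'| := abs_pos.2 hu
  rw [div_mul_eq_mul_div, le_div_iff₀ hpos]
  have h1 := congrArg (a n).mulVec (area_smul_eq u u' w)
  rw [Matrix.mulVec_add, Matrix.mulVec_smul, Matrix.mulVec_smul, Matrix.mulVec_smul] at h1
  have h2 : |area u u'| * ‖(a n).mulVec w‖ ≤
      2 * (‖w‖ * ‖u'‖) * ‖(a n).mulVec u‖ + 2 * (‖u‖ * ‖w‖) * ‖(a n).mulVec u'‖ := by
    calc |area u u'| * ‖(a n).mulVec w‖ = ‖area u u' • (a n).mulVec w‖ := by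
          rw [norm_smul, Real.norm_eq_abs]
      _ ≤ |area w u'| * ‖(a n).mulVec u‖ + |area u w| * ‖(a n).mulVec u'‖ := by
        rw [h1]
        refine (norm_add_le _ _).trans ?_
        rw [norm_smul, norm_smul, Real.norm_eq_abs, Real.norm_eq_abs]
      _ ≤ _ := by
        have := abs_area_le w u'
        have := abs_area_le u w
        gcongr
  calc ‖(a n).mulVec w‖ * ‖(a n).mulVec v‖ * |area u u'|
      = (|area u u'| * ‖(a n).mulVec w‖) * ‖(a n).mulVec v‖ := by ring
    _ ≤ (2 * (‖w‖ * ‖u'‖) * ‖(a n).mulVec u‖ + 2 * (‖u‖ * ‖w‖) * ‖(a n).mulVec u'‖) *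
        ‖(a n).mulVec v‖ := by gcongr
    _ = 2 * (‖w‖ * ‖u'‖) * (‖(a n).mulVec u‖ * ‖(a n).mulVec v‖) +
        2 * (‖u‖ * ‖w‖) * (‖(a n).mulVec u'‖ * ‖(a n).mulVec v‖) := by ring
    _ ≤ 2 * (‖w‖ * ‖u'‖) * (|area v u| / κ) + 2 * (‖u‖ * ‖w‖) * (|area v u'| / κ) := by
        have := bound n u (h n)
        have := bound n u' (h' n)
        gcongr
    _ = _ := by ring

theorem ConicalAt.mul_right {a : ℕ → Matrix (Fin 2) (Fin 2) ℝ} {v : Fin 2 → ℝ}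
    {B : Matrix (Fin 2) (Fin 2) ℝ} (h : ConicalAt a (B.mulVec v)) :
    ConicalAt (fun n => a n * B) v := by
  obtain ⟨C, hC⟩ := h
  let f := LinearMap.toContinuousLinearMap (Matrix.mulVecLin B)
  refine ⟨|C| * ‖f‖, fun n w => ?_⟩
  rw [← Matrix.mulVec_mulVec, ← Matrix.mulVec_mulVec]
  have h1 : ‖B.mulVec w‖ ≤ ‖f‖ * ‖w‖ := f.le_opNorm w
  calc _ ≤ C * ‖B.mulVec w‖ := hC n _
    _ ≤ |C| * ‖B.mulVec w‖ := by gcongr; exact le_abs_self C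
    _ ≤ |C| * (‖f‖ * ‖w‖) := by gcongr
    _ = _ := by ring

/-- Where the image of `v` is not small, conicality bounds the whole matrix, and discreteness leaves
only finitely many such elements. -/
theorem ConicalAt.tendsto_zero {Γ : Subgroup PGL(2, ℝ)} (hΓ : DiscreteTopology Γ)
    {a : ℕ → Matrix (Fin 2) (Fin 2) ℝ} {g : ℕ → Γ} (ha : ∀ n, IsLift (a n) (g n : PGL(2, ℝ)))
    (hg : Function.Injective g) {v : Fin 2 → ℝ} (h : ConicalAt a v) :
    Tendsto (fun n => ‖(a n).mulVec v‖) atTop (𝓝 0) := by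
  obtain ⟨C, hC⟩ := h
  rw [Metric.tendsto_atTop']
  intro ε hε
  have hfin : {n | ε ≤ ‖(a n).mulVec v‖}.Finite := by
    refine ((finite_bounded_lifts hΓ (C / ε)).preimage hg.injOn).subset fun n hn => ?_
    refine ⟨a n, ha n, fun i j => (abs_apply_le_norm_mulVec _ i j).trans ?_⟩
    rw [le_div_iff₀ hε]
    calc _ ≤ ‖(a n).mulVec (Pi.single j 1)‖ * ‖(a n).mulVec v‖ := by gcongr; exact hn
      _ ≤ C * ‖(Pi.single j 1 : Fin 2 → ℝ)‖ := hC n _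
      _ = C := by rw [Pi.norm_single, norm_one, mul_one]
  obtain ⟨m, hm⟩ := hfin.bddAbove
  refine ⟨m, fun n hn => ?_⟩
  by_contra! hle
  rw [Real.dist_eq, sub_zero, abs_norm] at hle
  exact absurd (hm hle) (not_le.2 hn)

/-- Two sequences that converge conically to the same point shadow one another. -/
theorem exists_bounded_pairs {a b : ℕ → Matrix (Fin 2) (Fin 2) ℝ} {g g' : ℕ → PGL(2, ℝ)}
    (ha : ∀ n, IsLift (a n) (g n)) (hb : ∀ n, IsLift (b n) (g' n)) {v : Fin 2 → ℝ} (hv : v ≠ 0)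
    (hav : ConicalAt a v) (hbv : ConicalAt b v)
    (ha0 : Tendsto (fun n => ‖(a n).mulVec v‖) atTop (𝓝 0))
    (hb0 : Tendsto (fun n => ‖(b n).mulVec v‖) atTop (𝓝 0)) {D : ℝ}
    (hD : ∀ n, ‖(b n).mulVec v‖ ≤ D * ‖(b (n + 1)).mulVec v‖) :
    ∃ R : ℝ, ∃ n m : ℕ → ℕ, Tendsto n atTop atTop ∧ Tendsto m atTop atTop ∧
      ∀ k i j, |(b (m k) * (a (n k))⁻¹) i j| ≤ R := by
  have hpa : ∀ n, 0 < ‖(a n).mulVec v‖ := fun n => norm_pos_iff.2 ((ha n).mulVec_ne_zero hv)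
  have hpb : ∀ n, 0 < ‖(b n).mulVec v‖ := fun n => norm_pos_iff.2 ((hb n).mulVec_ne_zero hv)
  -- Starting a at k₀ makes the matching time m n positive, so it has a predecessor.
  obtain ⟨k₀, hk₀⟩ := (ha0.eventually (gt_mem_nhds (hpb 0))).exists_forall_of_atTop
  have hex : ∀ n, ∃ m, ‖(b m).mulVec v‖ ≤ ‖(a (n + k₀)).mulVec v‖ := fun n =>
    ((hb0.eventually (gt_mem_nhds (hpa (n + k₀)))).exists).imp fun _ h => h.le
  classical
  -- The first time at which b contracts v as far as a does; by hD it overshoots by a factor of at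
  -- most D.
  let m : ℕ → ℕ := fun n => Nat.find (hex n)
  have hm1 : ∀ n, ‖(b (m n)).mulVec v‖ ≤ ‖(a (n + k₀)).mulVec v‖ := fun n => Nat.find_spec (hex n)
  have hm2 : ∀ n, ‖(a (n + k₀)).mulVec v‖ ≤ D * ‖(b (m n)).mulVec v‖ := fun n => by
    have h0 : m n ≠ 0 := fun h0 => by
      have h1 := hm1 n
      rw [h0] at h1
      exact absurd (hk₀ (n + k₀) (Nat.le_add_left _ _)) (not_lt.2 h1)
    obtain ⟨j, hj⟩ := Nat.exists_eq_succ_of_ne_zero h0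
    have h2 : ¬ ‖(b j).mulVec v‖ ≤ ‖(a (n + k₀)).mulVec v‖ :=
      Nat.find_min (hex n) (by change j < m n; omega)
    rw [hj]
    exact (not_le.1 h2).le.trans (hD j)
  have hm : Tendsto m atTop atTop := by
    rw [tendsto_atTop]
    intro B
    have h1 : ∀ᶠ n in atTop, ∀ j ∈ Finset.range B, ‖(a (n + k₀)).mulVec v‖ < ‖(b j).mulVec v‖ := by
      rw [Filter.eventually_all_finset]
      exact fun j _ => (ha0.comp (tendsto_add_atTop_nat k₀)).eventually (gt_mem_nhds (hpb j))
    filter_upwards [h1] with n hn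
    by_contra! hlt
    exact absurd (hm1 n) (not_le.2 (hn _ (Finset.mem_range.2 hlt)))
  obtain ⟨Ca, hCa⟩ := hav
  obtain ⟨Cb, hCb⟩ := hbv
  obtain ⟨w, hw⟩ := exists_area_eq_one hv
  refine ⟨2 * (Ca * ‖w‖) + 2 * (Cb * ‖w‖ * D), fun k => k + k₀, m,
    tendsto_add_atTop_nat k₀, hm, fun k i j => (abs_apply_le_norm_mulVec _ i j).trans ?_⟩
  set y : Fin 2 → ℝ := Pi.single j 1 with hy
  have hy1 : ‖y‖ = 1 := by rw [hy, Pi.norm_single, norm_one]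
  set A := a (k + k₀) with hA
  set B := b (m k) with hB
  set c := ‖A.mulVec v‖ with hc
  set d := ‖B.mulVec v‖ with hd
  have hcpos : 0 < c := hpa _
  have hdpos : 0 < d := hpb _
  have hdc : d ≤ c := hm1 k
  have hcd : c ≤ D * d := hm2 k
  have hAw : ‖A.mulVec w‖ * c ≤ Ca * ‖w‖ := hCa _ w
  have hBw : ‖B.mulVec w‖ * d ≤ Cb * ‖w‖ := hCb _ w
  have harea : |area (A.mulVec v) (A.mulVec w)| = 1 := by
    rw [(ha _).abs_area_mulVec, hw, abs_one]
  -- Expand y in the basis A v, A w. Conicality bounds ‖A v‖ ‖A w‖ and ‖B v‖ ‖B w‖, and c and d are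
  -- comparable, so both terms of the image are bounded.
  have h1 := congrArg (B * A⁻¹).mulVec (area_smul_eq (A.mulVec v) (A.mulVec w) y)
  have h2 : ∀ x, (B * A⁻¹).mulVec (A.mulVec x) = B.mulVec x := fun x => by
    rw [← Matrix.mulVec_mulVec, (ha _).inv_mulVec_mulVec]
  rw [Matrix.mulVec_add, Matrix.mulVec_smul, Matrix.mulVec_smul, Matrix.mulVec_smul, h2, h2] at h1
  have h3 : |area y (A.mulVec w)| ≤ 2 * ‖A.mulVec w‖ := by
    simpa only [hy1, one_mul] using abs_area_le y (A.mulVec w)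
  have h4 : |area (A.mulVec v) y| ≤ 2 * c := by
    simpa only [hy1, mul_one] using abs_area_le (A.mulVec v) y
  calc ‖(B * A⁻¹).mulVec y‖
      = ‖area (A.mulVec v) (A.mulVec w) • (B * A⁻¹).mulVec y‖ := by
        rw [norm_smul, Real.norm_eq_abs, harea, one_mul]
    _ ≤ |area y (A.mulVec w)| * d + |area (A.mulVec v) y| * ‖B.mulVec w‖ := by
        rw [h1]
        refine (norm_add_le _ _).trans ?_
        rw [norm_smul, norm_smul, Real.norm_eq_abs, Real.norm_eq_abs]
    _ ≤ 2 * ‖A.mulVec w‖ * c + 2 * (D * d) * ‖B.mulVec w‖ := by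
        have h5 : |area (A.mulVec v) y| ≤ 2 * (D * d) := h4.trans (by linarith)
        have h6 : 0 ≤ D * d := hcpos.le.trans hcd
        gcongr
    _ = 2 * (‖A.mulVec w‖ * c) + 2 * ((‖B.mulVec w‖ * d) * D) := by ring
    _ ≤ _ := by
        have : 0 ≤ D := by
          by_contra! hneg
          nlinarith
        gcongr

end Conical

/-! ### Affine charts of the circle -/

section Chart

theorem add_ne_zero_of_area {e₁ e₂ : Fin 2 → ℝ} (he : area e₁ e₂ = 1) (r : ℝ) :
    r • e₁ + e₂ ≠ 0 := fun h => by
  have h1 : area e₁ (r • e₁ + e₂) = 1 := by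
    rw [area_add_right, area_smul_right, area_self, mul_zero, zero_add, he]
  rw [h] at h1
  simp [area] at h1

/-- The affine chart `r ↦ [r e₁ + e₂]` of the circle. -/
noncomputable def affineChart {e₁ e₂ : Fin 2 → ℝ} (he : area e₁ e₂ = 1) (r : ℝ) : IdealCircle :=
  Projectivization.mk ℝ (r • e₁ + e₂) (add_ne_zero_of_area he r)

variable {e₁ e₂ : Fin 2 → ℝ}

theorem area_add_add (he : area e₁ e₂ = 1) (r s : ℝ) : area (r • e₁ + e₂) (s • e₁ + e₂) = r - s := by
  have h := he
  simp only [area, Pi.add_apply, Pi.smul_apply, smul_eq_mul] at h ⊢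
  linear_combination (r - s) * h

theorem eq_smul_of_area_ne_zero (he : area e₁ e₂ = 1) {v : Fin 2 → ℝ} (h : area e₁ v ≠ 0) :
    v = area e₁ v • ((area v e₂ / area e₁ v) • e₁ + e₂) := by
  rw [smul_add, smul_smul, mul_div_cancel₀ _ h, ← area_smul_eq, he, one_smul]

theorem mk_eq_affineChart (he : area e₁ e₂ = 1) {v : Fin 2 → ℝ} (hv : v ≠ 0) (h : area e₁ v ≠ 0) :
    Projectivization.mk ℝ v hv = affineChart he (area v e₂ / area e₁ v) :=
  (Projectivization.mk_eq_mk_iff' ℝ _ _ _ _).2 ⟨_, (eq_smul_of_area_ne_zero he h).symm⟩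

theorem affineChart_injective (he : area e₁ e₂ = 1) : Function.Injective (affineChart he) := fun r s h => by
  have := (mk_eq_mk_iff_area _ _).1 h
  rw [area_add_add he] at this
  linarith

theorem continuous_affineChart (he : area e₁ e₂ = 1) : Continuous (affineChart he) :=
  Projectivization.continuous_mk'.comp
    (f := fun r : ℝ => (⟨r • e₁ + e₂, add_ne_zero_of_area he r⟩ : {v : Fin 2 → ℝ // v ≠ 0}))
    (by fun_prop)

theorem continuous_area_right (y : Fin 2 → ℝ) : Continuous fun x => area y x := by
  unfold area; fun_prop

theorem isOpenMap_affineChart (he : area e₁ e₂ = 1) : IsOpenMap (affineChart he) := by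
  intro U hU
  have h1 : Projectivization.mk' ℝ ⁻¹' (affineChart he '' U) =
      (Subtype.val ⁻¹' ({v | area e₁ v ≠ 0} ∩ (fun v => area v e₂ / area e₁ v) ⁻¹' U) :
        Set {v : Fin 2 → ℝ // v ≠ 0}) := by
    ext ⟨v, hv⟩
    simp only [mem_preimage, mem_image, Projectivization.mk'_eq_mk, mem_inter_iff, mem_ofPred_eq]
    constructor
    · rintro ⟨r, hr, h⟩
      obtain ⟨a, ha⟩ := (Projectivization.mk_eq_mk_iff' ℝ _ _ _ _).1 h.symm
      have ha0 : a ≠ 0 := by rintro rfl; simp at ha; exact hv ha.symm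
      have h2 : area e₁ v = a := by
        rw [← ha, area_smul_right, area_add_right, area_smul_right, area_self, he]; ring
      have h3 : area v e₂ = a * r := by
        rw [← ha, area_smul_left, area_comm, area_add_right, area_smul_right, area_self,
          area_comm e₂, he]; ring
      rw [h2, h3, mul_div_cancel_left₀ _ ha0]
      exact ⟨ha0, hr⟩
    · rintro ⟨h0, hU⟩
      exact ⟨_, hU, (mk_eq_affineChart he hv h0).symm⟩
  have h2 : IsOpen ({v | area e₁ v ≠ 0} ∩ (fun v => area v e₂ / area e₁ v) ⁻¹' U) := by
    refine ContinuousOn.isOpen_inter_preimage ?_ ?_ hU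
    · exact (continuous_area_left e₂).continuousOn.div (continuous_area_right e₁).continuousOn
        fun v hv => hv
    · exact isOpen_ne_fun (continuous_area_right e₁) continuous_const
  exact isOpen_coinduced.2 (h1 ▸ h2.preimage continuous_subtype_val)

theorem ne_zero_of_area_eq_one (he : area e₁ e₂ = 1) : e₁ ≠ 0 := fun h => by
  rw [h] at he
  simp [area] at he

theorem mem_range_affineChart (he : area e₁ e₂ = 1) {p : IdealCircle}
    (hp : p ≠ Projectivization.mk ℝ e₁ (ne_zero_of_area_eq_one he)) :
    p ∈ range (affineChart he) := by
  induction p using Projectivization.ind with | h v hv =>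
  refine ⟨_, (mk_eq_affineChart he hv fun h => hp ?_).symm⟩
  rw [mk_eq_mk_iff_area, area_comm, h, neg_zero]

/-- A proper closed interval that misses the point at infinity of the chart is a segment. -/
theorem IsProperClosedInterval.exists_preimage_eq_Icc (he : area e₁ e₂ = 1) {I : Set IdealCircle}
    (hI : IsProperClosedInterval I)
    (h : Projectivization.mk ℝ e₁ (ne_zero_of_area_eq_one he) ∉ I) :
    ∃ a b, a ≤ b ∧ affineChart he ⁻¹' I = Icc a b := by
  have hsub : I ⊆ range (affineChart he) := fun p hp =>
    mem_range_affineChart he fun h0 => h (h0 ▸ hp)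
  have hconn := hI.isConnected.preimage_of_isOpenMap (affineChart_injective he)
    (isOpenMap_affineChart he) hsub
  have hemb : IsOpenEmbedding (affineChart he) := .of_continuous_injective_isOpenMap
    (continuous_affineChart he) (affineChart_injective he) (isOpenMap_affineChart he)
  have hcomp : IsCompact (affineChart he ⁻¹' I) :=
    hemb.isInducing.isCompact_preimage' hI.isClosed.isCompact hsub
  have := eq_Icc_of_connected_compact hconn hcomp
  refine ⟨_, _, ?_, this⟩
  rw [← nonempty_Icc, ← this]
  exact hconn.nonempty

end Chart

/-! ### Derivative at an attracting fixed point -/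

section Attracting

/-- A hyperbolic isometry contracts near its attracting fixed point: the derivative `det M / l ^ 2`
there is less than one in absolute value. -/
theorem one_lt_sq_of_attracting {g : PGL(2, ℝ)} (hg : IsHyperbolicIsometry g)
    {v : Fin 2 → ℝ} (hv : v ≠ 0) (hx : IsAttractingFixedPoint g (Projectivization.mk ℝ v hv))
    {M : Matrix (Fin 2) (Fin 2) ℝ} (hM : IsLift M g) {l : ℝ} (hl : M.mulVec v = l • v) :
    1 < l ^ 2 := by
  obtain ⟨w, hw⟩ := exists_area_eq_one hv
  set μ := area v (M.mulVec w) with hμ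
  set k := area (M.mulVec w) w with hk
  have hMw : M.mulVec w = k • v + μ • w := by
    have := area_smul_eq v w (M.mulVec w)
    rwa [hw, one_smul] at this
  have hdet : l * μ = M.det := by
    have := area_mulVec M v w
    rw [hl, area_smul_left, hw, mul_one] at this
    exact this
  have htr : M.trace = l + μ := by
    have h1 : M.trace * area v w = area (M.mulVec v) w + area v (M.mulVec w) := by
      simp only [area, Matrix.mulVec, dotProduct, Fin.sum_univ_two, Matrix.trace_fin_two]
      ring
    rw [hw, hl, area_smul_left, hw] at h1
    linarith
  have hd2 : (l * μ) ^ 2 = 1 := by rw [hdet, sq, hM.det_mul_self]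
  -- Positive discriminant excludes equal eigenvalues, nonzero trace excludes opposite ones.
  obtain ⟨hlμ, hlμ'⟩ : l ≠ μ ∧ l + μ ≠ 0 := by
    obtain ⟨N, hN, hNM, -⟩ := hM
    obtain ⟨P, hP, hPh, hPt⟩ := hg
    obtain ⟨u, rfl⟩ := Matrix.ProjGenLinGroup.mk_eq_mk_iff.1 (hN.trans hP.symm)
    have hP : (N * Matrix.GeneralLinearGroup.scalar (Fin 2) u).val = (u : ℝ) • M := by
      ext i j
      simp [Matrix.GeneralLinearGroup.scalar, mul_comm, hNM]
    rw [hP, Matrix.trace_smul, smul_eq_mul, htr] at hPt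
    have hdisc : 0 < ((N * Matrix.GeneralLinearGroup.scalar (Fin 2) u).val).discr := hPh
    rw [hP, Matrix.discr_fin_two, Matrix.trace_smul, Matrix.det_smul, htr, ← hdet,
      Fintype.card_fin] at hdisc
    refine ⟨fun h => ?_, right_ne_zero_of_mul hPt⟩
    rw [h] at hdisc
    simp only [smul_eq_mul] at hdisc
    nlinarith
  have hμ0 : μ ≠ 0 := by rintro h; rw [h] at hd2; simp at hd2
  -- Otherwise |l / μ| < 1, and points near [v] but different from it are carried to the other
  -- eigenline [w'].
  by_contra! hle
  have hlt : |l / μ| < 1 := by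
    rw [abs_div, div_lt_one (abs_pos.2 hμ0)]
    refine sq_lt_sq.1 (lt_of_le_of_ne ?_ ?_)
    · have : 0 ≤ l ^ 2 := sq_nonneg l
      nlinarith [sq_nonneg μ]
    · intro h
      rcases sq_eq_sq_iff_eq_or_eq_neg.1 h with h | h
      · exact hlμ h
      · exact hlμ' (by rw [h]; ring)
  set w' := w + (k / (μ - l)) • v with hw'
  have hw'1 : area v w' = 1 := by
    rw [hw', area_add_right, area_smul_right, area_self, hw]; ring
  have hMw' : M.mulVec w' = μ • w' := by
    have h0 : μ - l ≠ 0 := sub_ne_zero.2 hlμ.symm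
    rw [hw', Matrix.mulVec_add, Matrix.mulVec_smul, hl, hMw]
    have : k = (k / (μ - l)) * (μ - l) := by field_simp
    funext i
    simp only [Pi.add_apply, Pi.smul_apply, smul_eq_mul]
    linear_combination v i * this
  have harea : ∀ q s : ℝ, area v (q • v + s • w') = s := fun q s => by
    rw [area_add_right, area_smul_right, area_smul_right, area_self, hw'1]; ring
  have hne : ∀ q s : ℝ, s ≠ 0 → q • v + s • w' ≠ 0 := fun q s hs h => by
    have := harea q s
    rw [h] at this
    simp [area] at this
    exact hs this.symm
  have hcv : ∀ s : ℝ, v + s • w' ≠ 0 := fun s => by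
    by_cases hs : s = 0
    · simpa [hs] using hv
    · simpa using hne 1 s hs
  have hcont : Tendsto (fun s : ℝ => Projectivization.mk ℝ (v + s • w') (hcv s)) (𝓝 0)
      (𝓝 (Projectivization.mk ℝ v hv)) := by
    refine Projectivization.tendsto_mk _ hv ?_
    have : Continuous fun s : ℝ => v + s • w' := by fun_prop
    simpa using this.tendsto 0
  obtain ⟨s, hs, hs0⟩ := ((hcont.eventually hx.2).filter_mono nhdsWithin_le_nhds |>.and
    (self_mem_nhdsWithin : {(0 : ℝ)}ᶜ ∈ 𝓝[≠] 0)).exists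
  replace hs0 : s ≠ 0 := hs0
  have hiter : ∀ n : ℕ, g ^ n • Projectivization.mk ℝ (v + s • w') (hcv s) =
      Projectivization.mk ℝ ((l / μ) ^ n • v + s • w') (hne _ s hs0) := by
    intro n
    induction n with
    | zero => simp
    | succ n ih =>
      rw [pow_succ', mul_smul, ih, hM.smul_mk, Projectivization.mk_eq_mk_iff']
      refine ⟨μ, ?_⟩
      rw [Matrix.mulVec_add, Matrix.mulVec_smul, Matrix.mulVec_smul, hl, hMw']
      funext i
      simp only [Pi.add_apply, Pi.smul_apply, smul_eq_mul, pow_succ]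
      field_simp
  have hlim : Tendsto (fun n : ℕ => g ^ n • Projectivization.mk ℝ (v + s • w') (hcv s)) atTop
      (𝓝 (Projectivization.mk ℝ ((0 : ℝ) • v + s • w') (hne 0 s hs0))) := by
    simp only [hiter]
    refine Projectivization.tendsto_mk _ _ ?_
    exact ((tendsto_pow_atTop_nhds_zero_of_abs_lt_one hlt).smul_const v).add_const _
  have h1 := tendsto_nhds_unique hs hlim
  rw [mk_eq_mk_iff_area, harea] at h1
  exact hs0 h1

end Attracting

/-! ### Estimates for enlarging an interval -/

section Enlargement

theorem eventually_mul_lt {c d : ℝ} (hd : 0 < d) :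
    ∀ᶠ ε in 𝓝[>] (0 : ℝ), c * ε < d := by
  have : Tendsto (fun ε : ℝ => c * ε) (𝓝[>] 0) (𝓝 (c * 0)) :=
    ((continuous_const_mul c).tendsto 0).mono_left nhdsWithin_le_nhds
  rw [mul_zero] at this
  exact this.eventually (gt_mem_nhds hd)

theorem Filter.Eventually.forall_abs_sub_lt {P : ℝ → Prop} {e : ℝ} (s : ℝ)
    (hP : ∀ᶠ r in 𝓝 e, P r) : ∀ᶠ ε in 𝓝[>] (0 : ℝ), ∀ r, |r - e| < s * ε → P r := by
  obtain ⟨δ, hδ, hδP⟩ := Metric.eventually_nhds_iff.1 hP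
  filter_upwards [eventually_mul_lt (c := s) hδ] with ε hε r hr
  exact hδP (by rw [Real.dist_eq]; linarith)

/-- A slope condition at an endpoint of `[a, b]` under which `φ` maps the enlargement of `[a, b]`
there into the enlarged interval. -/
theorem eventually_mapsTo_enlargement {a b κ s e : ℝ} (hab : a < b) (hκ : 0 < κ)
    {φ : ℝ → ℝ} (hφ : ContinuousAt φ e) (he : φ e ∈ Icc a b)
    (ha : φ e = a → ∃ L, 0 ≤ L ∧ L * s < 1 ∧ ∀ᶠ r in 𝓝 e, |φ r - φ e| ≤ L * |r - e|)
    (hb : φ e = b → ∃ L, 0 ≤ L ∧ L * s < κ ∧ ∀ᶠ r in 𝓝 e, |φ r - φ e| ≤ L * |r - e|) :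
    ∀ᶠ ε in 𝓝[>] (0 : ℝ), ∀ r, |r - e| < s * ε → φ r ∈ Ioo (a - ε) (b + κ * ε) := by
  have hba : 0 < b - a := by linarith
  rcases he.1.eq_or_lt with h | h
  · obtain ⟨L, hL0, hL, hLr⟩ := ha h.symm
    filter_upwards [hLr.forall_abs_sub_lt s, eventually_mul_lt (c := 1) hba, self_mem_nhdsWithin] with ε h1 h2 h3 r hr
    replace h3 : 0 < ε := h3
    have h4 := h1 r hr
    have h5 : |φ r - φ e| < ε := by nlinarith
    rw [abs_lt] at h5
    have : 0 < κ * ε := by positivity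
    constructor <;> linarith
  rcases he.2.eq_or_lt with h' | h'
  · obtain ⟨L, hL0, hL, hLr⟩ := hb h'
    filter_upwards [hLr.forall_abs_sub_lt s, eventually_mul_lt (c := κ) hba, self_mem_nhdsWithin] with ε h1 h2 h3 r hr
    replace h3 : 0 < ε := h3
    have h4 := h1 r hr
    have h5 : |φ r - φ e| < κ * ε := by nlinarith
    rw [abs_lt] at h5
    constructor <;> linarith
  · filter_upwards [(hφ.eventually (Ioo_mem_nhds h h')).forall_abs_sub_lt s, self_mem_nhdsWithin] with ε h1 h3 r hr
    replace h3 : 0 < ε := h3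
    have := h1 r hr
    have : 0 < κ * ε := by positivity
    constructor <;> linarith [(h1 r hr).1, (h1 r hr).2]

/-- Supplies the ratio κ of the enlargements at the two endpoints. -/
theorem exists_between_finite {F G : Set ℝ} (hF : F.Finite) (hG : G.Finite)
    (h : ∀ x ∈ F, ∀ y ∈ G, x < y) : ∃ c, (∀ x ∈ F, x < c) ∧ ∀ y ∈ G, c < y := by
  rcases F.eq_empty_or_nonempty with rfl | hFn
  · obtain ⟨m, hm⟩ := hG.bddBelow
    exact ⟨m - 1, by simp, fun y hy => by linarith [hm hy]⟩
  obtain ⟨x, hx, hxF⟩ := Set.exists_max_image F id hF hFn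
  rcases G.eq_empty_or_nonempty with rfl | hGn
  · exact ⟨x + 1, fun y hy => by linarith [hxF y hy, show id y = y from rfl, show id x = x from rfl], by simp⟩
  obtain ⟨y, hy, hyG⟩ := Set.exists_min_image G id hG hGn
  obtain ⟨c, hc1, hc2⟩ := exists_between (h x hx y hy)
  exact ⟨c, fun z hz => (hxF z hz).trans_lt hc1, fun z hz => hc2.trans_le (hyG z hz)⟩

end Enlargement

/-! ### An open enlargement of the interval -/

section NestingSystem

variable {Γ : Subgroup PGL(2, ℝ)} {I : Set IdealCircle} {T : Set Γ}

/-- A nonempty translate tI inside a one-point I would be all of I, against strictness. -/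
theorem IsNestingSystem.nontrivial (h : IsNestingSystem Γ I T) : I.Nontrivial := by
  rw [← not_subsingleton_iff]
  intro hs
  obtain ⟨x, hx⟩ := h.interval.isConnected.nonempty
  have hx' := hx
  rw [← h.cover, mem_iUnion₂] at hx'
  obtain ⟨t, ht, hxt⟩ := hx'
  refine (h.ssubset t ht).2 fun y hy => ?_
  rwa [hs hy hx]

/-- The interval of a nesting system has interior, and it has a proper open neighbourhood that is
nested in the same way. -/
theorem IsNestingSystem.exists_enlargement (h : IsNestingSystem Γ I T) :
    (interior I).Nonempty ∧ ∃ I' : Set IdealCircle, IsOpen I' ∧ I ⊆ I' ∧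
      (∀ t ∈ T, t • I' ⊆ I') ∧ ∃ z z', z ∉ I' ∧ z' ∉ I' ∧ z ≠ z' := by
  obtain ⟨z₀, hz₀⟩ := (ne_univ_iff_exists_notMem I).1 h.interval.ne_univ
  obtain ⟨e₁, he₁, rfl⟩ : ∃ v hv, Projectivization.mk ℝ v hv = z₀ :=
    ⟨z₀.rep, z₀.rep_nonzero, z₀.mk_rep⟩
  obtain ⟨e₂, he⟩ := exists_area_eq_one he₁
  obtain ⟨a, b, hab', hIcc⟩ := h.interval.exists_preimage_eq_Icc he hz₀
  set c := affineChart he with hc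
  have hcinj : Function.Injective c := affineChart_injective he
  have hmem : ∀ r, c r ∈ I ↔ r ∈ Icc a b := fun r => by rw [← hIcc]; rfl
  have hrange : ∀ p ∈ I, ∃ r, c r = p := fun p hp =>
    mem_range_affineChart he fun h0 => hz₀ (h0 ▸ hp)
  have hab : a < b := by
    refine hab'.lt_of_ne fun h0 => ?_
    obtain ⟨p, hp, q, hq, hpq⟩ := h.nontrivial
    obtain ⟨r, rfl⟩ := hrange p hp
    obtain ⟨s, rfl⟩ := hrange q hq
    rw [hmem, ← h0, Icc_self, mem_singleton_iff] at hp hq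
    exact hpq (by rw [hp, hq])
  have hIoo : c '' Ioo a b ⊆ I := by
    rintro _ ⟨r, hr, rfl⟩
    exact (hmem r).2 (Ioo_subset_Icc_self hr)
  refine ⟨((nonempty_Ioo.2 hab).image c).mono
    (interior_maximal hIoo (isOpenMap_affineChart he _ isOpen_Ioo)), ?_⟩
  choose M hM using fun t : Γ => exists_isLift (t : PGL(2, ℝ))
  let w : ℝ → Fin 2 → ℝ := fun r => r • e₁ + e₂
  have hw0 : ∀ r, w r ≠ 0 := add_ne_zero_of_area he
  have hwc : Continuous w := by fun_prop
  -- In the chart t acts by the Möbius map φ t, whose derivative has absolute value 1 / (den t r) ^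
  -- 2.
  let den : Γ → ℝ → ℝ := fun t r => area e₁ ((M t).mulVec (w r))
  let φ : Γ → ℝ → ℝ := fun t r => area ((M t).mulVec (w r)) e₂ / den t r
  have hMc : ∀ t, Continuous fun r => (M t).mulVec (w r) := fun t => by fun_prop
  have hdenc : ∀ t, Continuous (den t) := fun t => (continuous_area_right e₁).comp (hMc t)
  have hφc : ∀ t r, den t r ≠ 0 → ContinuousAt (φ t) r := fun t r hr =>
    (((continuous_area_left e₂).comp (hMc t)).continuousAt).div (hdenc t).continuousAt hr
  have act : ∀ t r, den t r ≠ 0 → t • c r = c (φ t r) := fun t r hr => by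
    change (t : PGL(2, ℝ)) • Projectivization.mk ℝ (w r) (hw0 r) = _
    rw [(hM t).smul_mk]
    exact mk_eq_affineChart he _ hr
  have hMw : ∀ t r, den t r ≠ 0 → (M t).mulVec (w r) = den t r • w (φ t r) := fun t r hr =>
    eq_smul_of_area_ne_zero he hr
  have hTI : ∀ t ∈ T, ∀ r ∈ Icc a b, den t r ≠ 0 ∧ φ t r ∈ Icc a b := by
    intro t ht r hr
    have h1 : t • c r ∈ I := (h.ssubset t ht).1 (smul_mem_smul_set ((hmem r).2 hr))
    have h2 : den t r ≠ 0 := fun h0 => by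
      refine hz₀ ?_
      convert h1 using 1
      change _ = (t : PGL(2, ℝ)) • Projectivization.mk ℝ (w r) (hw0 r)
      rw [(hM t).smul_mk, mk_eq_mk_iff_area]
      exact h0
    rw [act t r h2, hmem] at h1
    exact ⟨h2, h1⟩
  have hdiff : ∀ t r s, den t r ≠ 0 → den t s ≠ 0 →
      |φ t r - φ t s| = (|den t r| * |den t s|)⁻¹ * |r - s| := by
    intro t r s hr hs
    have h1 := (hM t).abs_area_mulVec (w r) (w s)
    rw [hMw t r hr, hMw t s hs, area_smul_left, area_smul_right, area_add_add he,
      area_add_add he, abs_mul, abs_mul] at h1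
    have := abs_pos.2 hr
    have := abs_pos.2 hs
    rw [← h1]
    field_simp
  have slope : ∀ t ∈ T, ∀ e ∈ Icc a b, ∀ L, ((den t e) ^ 2)⁻¹ < L →
      ∀ᶠ r in 𝓝 e, |φ t r - φ t e| ≤ L * |r - e| := by
    intro t ht e he' L hL
    have h0 := (hTI t ht e he').1
    have h1 : ContinuousAt (fun r => (|den t r| * |den t e|)⁻¹) e :=
      (((hdenc t).abs.continuousAt).mul continuousAt_const).inv₀
        (mul_ne_zero (abs_ne_zero.2 h0) (abs_ne_zero.2 h0))
    have h2 : (|den t e| * |den t e|)⁻¹ < L := by rwa [abs_mul_abs_self, ← sq]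
    filter_upwards [h1.eventually (gt_mem_nhds h2),
      (hdenc t).continuousAt.eventually_ne h0] with r hr hr0
    rw [hdiff t r e hr0 h0]
    gcongr
  have hfront : ∀ e, e ∈ Icc a b → e ∉ Ioo a b → c e ∈ frontier I := by
    intro e he' hne
    rw [h.interval.isClosed.frontier_eq]
    refine ⟨(hmem e).2 he', fun hint => hne ?_⟩
    have : c ⁻¹' interior I ⊆ interior (Icc a b) := by
      rw [← hIcc]
      exact interior_maximal (preimage_mono interior_subset)
        (isOpen_interior.preimage (continuous_affineChart he))
    rw [interior_Icc] at this
    exact this hint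
  have hfix : ∀ t ∈ T, ∀ e ∈ Icc a b, e ∉ Ioo a b → φ t e = e → 1 < (den t e) ^ 2 := by
    intro t ht e he' hne hte
    have h0 := (hTI t ht e he').1
    have h1 : t • c e = c e := by rw [act t e h0, hte]
    obtain ⟨h2, h3⟩ := h.attracting t (Or.inl ht) _ (hfront e he' hne) h1
    refine one_lt_sq_of_attracting h2 (hw0 e) h3 (hM t) ?_
    rw [hMw t e h0, hte]
  have ha : a ∈ Icc a b := left_mem_Icc.2 hab'
  have hb : b ∈ Icc a b := right_mem_Icc.2 hab'
  have ha' : a ∉ Ioo a b := fun h => lt_irrefl _ h.1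
  have hb' : b ∉ Ioo a b := fun h => lt_irrefl _ h.2
  -- Here the endpoint condition on products of two elements enters: t and s may exchange the
  -- endpoints, and then s * t fixes a.
  have hfix2 : ∀ t ∈ T, ∀ s ∈ T, φ t a = b → φ s b = a → 1 < (den s b * den t a) ^ 2 := by
    intro t ht s hs hta hsb
    have ht0 := (hTI t ht a ha).1
    have hs0 := (hTI s hs b hb).1
    have h1 : (s * t) • c a = c a := by rw [mul_smul, act t a ht0, hta, act s b hs0, hsb]
    obtain ⟨h2, h3⟩ := h.attracting (s * t) (Or.inr (mul_mem_mul hs ht)) _ (hfront a ha ha') h1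
    refine one_lt_sq_of_attracting h2 (hw0 a) h3 ((hM s).mul (hM t)) ?_
    rw [← Matrix.mulVec_mulVec, hMw t a ht0, hta, Matrix.mulVec_smul, hMw s b hs0, hsb, smul_smul,
      mul_comm]
  -- The interval grows by ε at a and by κ * ε at b. An element taking a to b needs its slope below
  -- κ, one taking b to a needs its slope below 1 / κ; hfix2 makes these compatible, and the
  -- inserted 0 makes κ positive.
  obtain ⟨κ, hκF, hκG⟩ := exists_between_finite
    (F := insert 0 ((fun t => ((den t a) ^ 2)⁻¹) '' {t ∈ T | φ t a = b}))
    (G := (fun t => (den t b) ^ 2) '' {t ∈ T | φ t b = a})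
    (((h.finite.subset (sep_subset _ _)).image _).insert 0)
    ((h.finite.subset (sep_subset _ _)).image _) (by
      rintro x hx y ⟨s, ⟨hs, hsb⟩, rfl⟩
      have hs0 : 0 < (den s b) ^ 2 := by have := (hTI s hs b hb).1; positivity
      rcases hx with rfl | ⟨t, ⟨ht, hta⟩, rfl⟩
      · exact hs0
      have ht0 : 0 < (den t a) ^ 2 := by have := (hTI t ht a ha).1; positivity
      have := hfix2 t ht s hs hta hsb
      rw [mul_pow] at this
      exact (inv_lt_iff_one_lt_mul₀ ht0).2 this)
  have hκ : 0 < κ := hκF 0 (mem_insert _ _)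
  have hslope : ∀ t ∈ T, ∀ e ∈ Icc a b, ∀ s d, 0 < s → ((den t e) ^ 2)⁻¹ < d / s →
      ∃ L, 0 ≤ L ∧ L * s < d ∧ ∀ᶠ r in 𝓝 e, |φ t r - φ t e| ≤ L * |r - e| := by
    intro t ht e he' s d hs hd
    obtain ⟨L, hL1, hL2⟩ := exists_between hd
    exact ⟨L, (inv_nonneg.2 (sq_nonneg _)).trans hL1.le, (lt_div_iff₀ hs).1 hL2,
      slope t ht e he' L hL1⟩
  have hA : ∀ t ∈ T, ∀ᶠ ε in 𝓝[>] (0 : ℝ), ∀ r, |r - a| < 1 * ε →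
      φ t r ∈ Ioo (a - ε) (b + κ * ε) := fun t ht =>
    eventually_mapsTo_enlargement hab hκ (hφc t a (hTI t ht a ha).1) (hTI t ht a ha).2
      (fun hta => hslope t ht a ha 1 1 one_pos (by
        rw [div_one]; exact inv_lt_one_of_one_lt₀ (hfix t ht a ha ha' hta)))
      (fun hta => hslope t ht a ha 1 κ one_pos (by
        rw [div_one]; exact hκF _ (Or.inr ⟨t, ⟨ht, hta⟩, rfl⟩)))
  have hB : ∀ t ∈ T, ∀ᶠ ε in 𝓝[>] (0 : ℝ), ∀ r, |r - b| < κ * ε →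
      φ t r ∈ Ioo (a - ε) (b + κ * ε) := fun t ht =>
    eventually_mapsTo_enlargement hab hκ (hφc t b (hTI t ht b hb).1) (hTI t ht b hb).2
      (fun htb => hslope t ht b hb κ 1 hκ (by
        rw [one_div]; exact (inv_lt_inv₀ (by have := (hTI t ht b hb).1; positivity) hκ).2
          (hκG _ ⟨t, ⟨ht, htb⟩, rfl⟩)))
      (fun htb => hslope t ht b hb κ κ hκ (by
        rw [div_self hκ.ne']; exact inv_lt_one_of_one_lt₀ (hfix t ht b hb hb' htb)))
  have hA0 : ∀ t ∈ T, ∀ᶠ ε in 𝓝[>] (0 : ℝ), ∀ r, |r - a| < 1 * ε → den t r ≠ 0 := fun t ht =>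
    ((hdenc t).continuousAt.eventually_ne (hTI t ht a ha).1).forall_abs_sub_lt 1
  have hB0 : ∀ t ∈ T, ∀ᶠ ε in 𝓝[>] (0 : ℝ), ∀ r, |r - b| < κ * ε → den t r ≠ 0 := fun t ht =>
    ((hdenc t).continuousAt.eventually_ne (hTI t ht b hb).1).forall_abs_sub_lt κ
  have hall : ∀ᶠ ε in 𝓝[>] (0 : ℝ), ∀ t ∈ T,
      ((∀ r, |r - a| < 1 * ε → φ t r ∈ Ioo (a - ε) (b + κ * ε)) ∧
        ∀ r, |r - a| < 1 * ε → den t r ≠ 0) ∧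
      ((∀ r, |r - b| < κ * ε → φ t r ∈ Ioo (a - ε) (b + κ * ε)) ∧
        ∀ r, |r - b| < κ * ε → den t r ≠ 0) := by
    rw [Filter.eventually_all_finite h.finite]
    exact fun t ht => ((hA t ht).and (hA0 t ht)).and ((hB t ht).and (hB0 t ht))
  obtain ⟨ε, hε, hε0⟩ := (hall.and self_mem_nhdsWithin).exists
  replace hε0 : 0 < ε := hε0
  have hκε : 0 < κ * ε := by positivity
  refine ⟨c '' Ioo (a - ε) (b + κ * ε), isOpenMap_affineChart he _ isOpen_Ioo, ?_, ?_,
    c (b + κ * ε), c (b + κ * ε + 1), ?_, ?_, fun h0 => ?_⟩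
  · intro p hp
    obtain ⟨r, rfl⟩ := hrange p hp
    obtain ⟨h1, h2⟩ := (hmem r).1 hp
    exact ⟨r, ⟨by linarith, by linarith⟩, rfl⟩
  · rintro t ht _ ⟨_, ⟨r, ⟨hr1, hr2⟩, rfl⟩, rfl⟩
    obtain ⟨⟨hφa, hda⟩, hφb, hdb⟩ := hε t ht
    obtain ⟨hd, hφ⟩ : den t r ≠ 0 ∧ φ t r ∈ Ioo (a - ε) (b + κ * ε) := by
      rcases lt_or_ge r a with hra | hra
      · have : |r - a| < 1 * ε := by rw [abs_of_neg (by linarith)]; linarith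
        exact ⟨hda r this, hφa r this⟩
      rcases le_or_gt r b with hrb | hrb
      · obtain ⟨h1, h2, h3⟩ := hTI t ht r ⟨hra, hrb⟩
        exact ⟨h1, by linarith, by linarith⟩
      · have : |r - b| < κ * ε := by rw [abs_of_pos (by linarith)]; linarith
        exact ⟨hdb r this, hφb r this⟩
    exact ⟨φ t r, hφ, (act t r hd).symm⟩
  · rintro ⟨r, hr, hrc⟩
    have := hcinj hrc
    linarith [hr.2]
  · rintro ⟨r, hr, hrc⟩
    have := hcinj hrc
    linarith [hr.2]
  · have := hcinj h0
    linarith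

end NestingSystem

/-! ### Angles between disjoint closed sets -/

section Separation

theorem exists_area_lower_bound {S S' : Set IdealCircle} (hS : IsClosed S) (hS' : IsClosed S')
    (hd : Disjoint S S') : ∃ κ > 0, ∀ v ∈ coneOver S, ∀ u ∈ coneOver S',
      κ * (‖v‖ * ‖u‖) ≤ |area v u| := by
  have hcomp : ∀ {S : Set IdealCircle}, IsClosed S →
      IsCompact (coneOver S ∩ Metric.sphere (0 : Fin 2 → ℝ) 1) := by
    intro S hS
    have : coneOver S ∩ Metric.sphere (0 : Fin 2 → ℝ) 1 =
        Metric.sphere 0 1 ∩ insert 0 (coneOver S) := by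
      ext v
      constructor
      · exact fun ⟨h1, h2⟩ => ⟨h2, Or.inr h1⟩
      · rintro ⟨h2, rfl | h1⟩
        · simp at h2
        · exact ⟨h1, h2⟩
    rw [this]
    exact (isCompact_sphere _ _).inter_right (isClosed_insert_zero_coneOver hS)
  have hcont : Continuous fun p : (Fin 2 → ℝ) × (Fin 2 → ℝ) => |area p.1 p.2| := by
    unfold area; fun_prop
  obtain ⟨κ, hκ, hκb⟩ := ((hcomp hS).prod (hcomp hS')).exists_forall_le' (a := 0)
    hcont.continuousOn (by
      rintro ⟨v, u⟩ ⟨⟨⟨hv, hvS⟩, -⟩, ⟨hu, huS⟩, -⟩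
      refine abs_pos.2 fun h0 => ?_
      exact disjoint_left.1 hd hvS ((mk_eq_mk_iff_area hv hu).2 h0 ▸ huS))
  refine ⟨κ, hκ, fun v hv u hu => ?_⟩
  have hv0 : 0 < ‖v‖ := norm_pos_iff.2 hv.1
  have hu0 : 0 < ‖u‖ := norm_pos_iff.2 hu.1
  have := hκb (‖v‖⁻¹ • v, ‖u‖⁻¹ • u)
    ⟨⟨smul_mem_coneOver hv (inv_ne_zero hv0.ne'), by simp [norm_smul, hv0.ne']⟩,
      smul_mem_coneOver hu (inv_ne_zero hu0.ne'), by simp [norm_smul, hu0.ne']⟩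
  rw [area_smul_left, area_smul_right, abs_mul, abs_mul, abs_of_pos (inv_pos.2 hv0),
    abs_of_pos (inv_pos.2 hu0)] at this
  calc κ * (‖v‖ * ‖u‖) ≤ (‖v‖⁻¹ * (‖u‖⁻¹ * |area v u|)) * (‖v‖ * ‖u‖) := by gcongr
    _ = |area v u| := by field_simp

/-- Points whose lifts are bounded below converge to `[v]` if their area with `v` tends to zero. -/
theorem tendsto_mk_of_tendsto_area {X : ℕ → Fin 2 → ℝ} (hX : ∀ n, X n ≠ 0) {c : ℝ} (hc : 0 < c)
    (hXc : ∀ᶠ n in atTop, c ≤ ‖X n‖) {v : Fin 2 → ℝ} (hv : v ≠ 0)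
    (h : Tendsto (fun n => area v (X n)) atTop (𝓝 0)) :
    Tendsto (fun n => Projectivization.mk ℝ (X n) (hX n)) atTop (𝓝 (Projectivization.mk ℝ v hv)) := by
  intro U hU
  obtain ⟨W, hWU, hW, hvW⟩ := mem_nhds_iff.1 hU
  obtain ⟨κ, hκ, hκb⟩ := exists_area_lower_bound (isClosed_singleton (x := Projectivization.mk ℝ v hv))
    hW.isClosed_compl (disjoint_singleton_left.2 (notMem_compl_iff.2 hvW))
  have hv0 : 0 < ‖v‖ := norm_pos_iff.2 hv
  have habs : Tendsto (fun n => |area v (X n)|) atTop (𝓝 0) := by simpa using h.abs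
  rw [Filter.mem_map]
  filter_upwards [habs.eventually (gt_mem_nhds (show 0 < κ * (‖v‖ * c) by positivity)), hXc]
    with n hn hcn
  refine hWU ?_
  by_contra hnW
  have h1 := hκb v ⟨hv, rfl⟩ (X n) ⟨hX n, hnW⟩
  have h2 : κ * (‖v‖ * c) ≤ κ * (‖v‖ * ‖X n‖) := by gcongr
  linarith

end Separation

/-! ### Codings of points of the interval -/

section NestingDynamics

variable {Γ : Subgroup PGL(2, ℝ)} {I : Set IdealCircle} {T : Set Γ}

/-- `x` lies in all the intervals `t 0 ⋯ t (n - 1) I`. -/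
def Codes (I : Set IdealCircle) (t : ℕ → T) (x : IdealCircle) : Prop :=
  ∀ n, x ∈ prefixProd (fun i => (t i : Γ)) n • I

namespace IsNestingSystem

theorem exists_codes (h : IsNestingSystem Γ I T) {x : IdealCircle} (hx : x ∈ I) :
    ∃ t : ℕ → T, Codes I t x := by
  have hstep : ∀ y : I, ∃ t : T, (t : Γ)⁻¹ • (y : IdealCircle) ∈ I := by
    rintro ⟨y, hy⟩
    rw [← h.cover, mem_iUnion₂] at hy
    obtain ⟨t, ht, hyt⟩ := hy
    exact ⟨⟨t, ht⟩, mem_smul_set_iff_inv_smul_mem.1 hyt⟩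
  choose f hf using hstep
  let y : ℕ → I := fun n => Nat.rec ⟨x, hx⟩ (fun _ y => ⟨_, hf y⟩) n
  have hy : ∀ n, prefixProd (fun i => (f (y i) : Γ)) n • (y n).1 = x := by
    intro n
    induction n with
    | zero => simp [y]
    | succ n ih =>
      rw [prefixProd_succ, mul_smul]
      have : (y (n + 1)).1 = (f (y n) : Γ)⁻¹ • (y n).1 := rfl
      rw [this, smul_inv_smul, ih]
  exact ⟨fun n => f (y n), fun n => ⟨(y n).1, (y n).2, hy n⟩⟩

/-- The translates of `I` by the prefixes decrease strictly. Distinctness is what lets discreteness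
act on the prefixes. -/
theorem prefixProd_injective (h : IsNestingSystem Γ I T) (t : ℕ → T) :
    Function.Injective (prefixProd fun i => (t i : Γ)) := by
  have : StrictAnti fun n => prefixProd (fun i => (t i : Γ)) n • I :=
    strictAnti_nat_of_succ_lt fun n => by
      rw [prefixProd_succ, mul_smul]
      exact ⟨smul_set_mono (h.ssubset _ (t n).2).1, fun h' =>
        (h.ssubset _ (t n).2).2 (smul_set_subset_smul_set_iff.1 h')⟩
  exact fun m n hmn => this.injective (congrArg (· • I) hmn)

/-- Inverse prefixes keep `v` in `I` and keep the complement of the enlargement `I'` in itself, so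
the angle between them never degenerates. Two points outside `I'` serve as the basis. -/
theorem conicalAt (h : IsNestingSystem Γ I T) {t : ℕ → T} {v : Fin 2 → ℝ} (hv : v ≠ 0)
    (ht : Codes I t (Projectivization.mk ℝ v hv)) {a : ℕ → Matrix (Fin 2) (Fin 2) ℝ}
    (ha : ∀ n, IsLift (a n) ((prefixProd (fun i => (t i : Γ)) n)⁻¹ : Γ)) : ConicalAt a v := by
  obtain ⟨-, I', hI', hII', hT, z, z', hz, hz', hzz⟩ := h.exists_enlargement
  obtain ⟨κ, hκ, hκb⟩ := exists_area_lower_bound h.interval.isClosed hI'.isClosed_compl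
    (disjoint_compl_right_iff_subset.2 hII')
  have hvI : ∀ n, (a n).mulVec v ∈ coneOver I := fun n => by
    refine ⟨(ha n).mulVec_ne_zero hv, ?_⟩
    rw [← (ha n).smul_mk hv]
    exact mem_smul_set_iff_inv_smul_mem.1 (ht n)
  have hout : ∀ z : IdealCircle, z ∉ I' → ∀ n, (a n).mulVec z.rep ∈ coneOver I'ᶜ := by
    intro z hz n
    refine ⟨(ha n).mulVec_ne_zero z.rep_nonzero, fun hmem => hz ?_⟩
    rw [← (ha n).smul_mk z.rep_nonzero, z.mk_rep] at hmem
    exact smul_prefixProd_subset (fun i => hT _ (t i).2) n (mem_smul_set_iff_inv_smul_mem.2 hmem)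
  refine conicalAt_of_area ha (u := z.rep) (u' := z'.rep) (fun h0 => hzz ?_) hκ
    (fun n => hκb _ (hvI n) _ (hout z hz n)) (fun n => hκb _ (hvI n) _ (hout z' hz' n))
  have := (mk_eq_mk_iff_area z.rep_nonzero z'.rep_nonzero).2 h0
  rwa [z.mk_rep, z'.mk_rep] at this

/-- Lifts of the inverse prefix products whose consecutive quotients are uniformly bounded. -/
theorem exists_lifts (h : IsNestingSystem Γ I T) : ∃ D : ℝ, ∀ t : ℕ → T,
    ∃ a : ℕ → Matrix (Fin 2) (Fin 2) ℝ,
      (∀ n, IsLift (a n) ((prefixProd (fun i => (t i : Γ)) n)⁻¹ : Γ)) ∧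
      ∀ n v, ‖(a n).mulVec v‖ ≤ D * ‖(a (n + 1)).mulVec v‖ := by
  choose M hM using fun t : Γ => exists_isLift (t : PGL(2, ℝ))
  let f : Γ → (Fin 2 → ℝ) →L[ℝ] (Fin 2 → ℝ) := fun t =>
    LinearMap.toContinuousLinearMap (Matrix.mulVecLin (M t))
  obtain ⟨D, hD⟩ := (h.finite.image fun t => ‖f t‖).bddAbove
  refine ⟨D, fun t => ?_⟩
  let a : ℕ → Matrix (Fin 2) (Fin 2) ℝ := fun n => Nat.rec 1 (fun k A => (M (t k))⁻¹ * A) n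
  refine ⟨a, fun n => ?_, fun n v => ?_⟩
  · induction n with
    | zero => simpa [a] using IsLift.one
    | succ n ih =>
      rw [prefixProd_succ, mul_inv_rev]
      exact (hM (t n)).inv.mul ih
  · have h1 : (a n).mulVec v = (M (t n)).mulVec ((a (n + 1)).mulVec v) := by
      have : a (n + 1) = (M (t n))⁻¹ * a n := rfl
      rw [this, ← Matrix.mulVec_mulVec, (hM _).mulVec_inv_mulVec]
    rw [h1]
    refine ((f (t n)).le_opNorm _).trans ?_
    have := hD ⟨_, (t n).2, rfl⟩
    gcongr

/-- The inverse prefixes of `t`, and those of `s` followed on the right by `γ`, both converge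
conically at `x`. Matched at equal scales their quotients are bounded, hence finite in number. -/
theorem exists_shadowing (h : IsNestingSystem Γ I T) (hΓ : DiscreteTopology Γ) {t s : ℕ → T} {γ : Γ}
    {x : IdealCircle} (ht : Codes I t x) (hs : Codes I s (γ • x)) :
    ∃ F : Set Γ, F.Finite ∧ ∃ n m : ℕ → ℕ, Tendsto n atTop atTop ∧ Tendsto m atTop atTop ∧
      ∀ k, (prefixProd (fun i => (s i : Γ)) (m k))⁻¹ * γ *
        prefixProd (fun i => (t i : Γ)) (n k) ∈ F := by
  obtain ⟨D, hD⟩ := h.exists_lifts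
  obtain ⟨a, ha, -⟩ := hD t
  obtain ⟨b, hb, hbD⟩ := hD s
  obtain ⟨B, hB⟩ := exists_isLift (γ : PGL(2, ℝ))
  induction x using Projectivization.ind with | h v hv =>
  have hb' : ∀ n, IsLift (b n * B) ((prefixProd (fun i => (s i : Γ)) n)⁻¹ * γ : Γ) :=
    fun n => (hb n).mul hB
  have hav := h.conicalAt hv ht ha
  have hbv : ConicalAt (fun n => b n * B) v := by
    refine ConicalAt.mul_right (h.conicalAt (hB.mulVec_ne_zero hv) ?_ hb)
    rw [← hB.smul_mk hv]
    exact hs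
  have hinj : Function.Injective fun n => (prefixProd (fun i => (s i : Γ)) n)⁻¹ * γ :=
    (mul_left_injective γ).comp (inv_injective.comp (h.prefixProd_injective s))
  obtain ⟨R, n, m, hn, hm, hR⟩ := exists_bounded_pairs ha hb' hv hav hbv
    (hav.tendsto_zero hΓ ha (inv_injective.comp (h.prefixProd_injective t)))
    (hbv.tendsto_zero hΓ hb' hinj) (D := D) (fun n => by
      rw [← Matrix.mulVec_mulVec, ← Matrix.mulVec_mulVec]; exact hbD n _)
  refine ⟨_, finite_bounded_lifts hΓ R, n, m, hn, hm, fun k => ⟨_, ?_, hR k⟩⟩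
  have := (hb' (m k)).mul (ha (n k)).inv
  simpa using this

theorem exists_contracting_sequence (h : IsNestingSystem Γ I T) (hΓ : DiscreteTopology Γ)
    {v : Fin 2 → ℝ} (hv : v ≠ 0) (hvI : Projectivization.mk ℝ v hv ∈ I) :
    ∃ (g : ℕ → Γ) (a : ℕ → Matrix (Fin 2) (Fin 2) ℝ), (∀ n, IsLift (a n) (g n : PGL(2, ℝ))) ∧
      Tendsto (fun n => ‖(a n)⁻¹.mulVec v‖) atTop (𝓝 0) := by
  obtain ⟨t, ht⟩ := h.exists_codes hvI
  obtain ⟨D, hD⟩ := h.exists_lifts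
  obtain ⟨a, ha, -⟩ := hD t
  refine ⟨prefixProd fun i => (t i : Γ), fun n => (a n)⁻¹, fun n => by simpa using (ha n).inv, ?_⟩
  refine ((h.conicalAt hv ht ha).tendsto_zero hΓ ha
    (inv_injective.comp (h.prefixProd_injective t))).congr fun n => ?_
  rw [Matrix.nonsing_inv_nonsing_inv _ (ha n).det_ne_zero.isUnit]

end IsNestingSystem

end NestingDynamics

/-! ### Every orbit meets the interior of the interval -/

section Minimality

variable {Γ : Subgroup PGL(2, ℝ)} {I : Set IdealCircle} {T : Set Γ}

theorem norm_mulVec_inv_area_bound {M : Matrix (Fin 2) (Fin 2) ℝ} {g : PGL(2, ℝ)}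
    (hM : IsLift M g) (v q : Fin 2 → ℝ) :
    |area v (M.mulVec q)| ≤ 2 * (‖M⁻¹.mulVec v‖ * ‖q‖) := by
  have := hM.abs_area_mulVec (M⁻¹.mulVec v) q
  rw [hM.mulVec_inv_mulVec] at this
  rw [this]
  exact abs_area_le _ _

theorem IsLift.tendsto_area {v : Fin 2 → ℝ} {g : ℕ → Γ} {a : ℕ → Matrix (Fin 2) (Fin 2) ℝ}
    (ha : ∀ n, IsLift (a n) (g n : PGL(2, ℝ)))
    (ha0 : Tendsto (fun n => ‖(a n)⁻¹.mulVec v‖) atTop (𝓝 0)) (q : Fin 2 → ℝ) :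
    Tendsto (fun n => area v ((a n).mulVec q)) atTop (𝓝 0) := by
  refine squeeze_zero_norm (fun n => norm_mulVec_inv_area_bound (ha n) v q) ?_
  simpa using (ha0.mul_const ‖q‖).const_mul 2

namespace IsNestingSystem

/-- An orbit that avoids the interior of `I` is a fixed point. -/
theorem smul_eq_of_orbit_avoids (h : IsNestingSystem Γ I T) (hΓ : DiscreteTopology Γ)
    {x : IdealCircle} (hx : ∀ γ : Γ, γ • x ∉ interior I) (γ : Γ) : γ • x = x := by
  by_contra hne
  obtain ⟨y, hy⟩ := h.exists_enlargement.1
  induction y using Projectivization.ind with | h v hv =>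
  obtain ⟨g, a, ha, ha0⟩ := h.exists_contracting_sequence hΓ hv (interior_subset hy)
  obtain ⟨κ, hκ, hκb⟩ := exists_area_lower_bound
    (isClosed_singleton (x := Projectivization.mk ℝ v hv)) isOpen_interior.isClosed_compl
    (disjoint_singleton_left.2 (notMem_compl_iff.2 hy))
  have hv0 : 0 < ‖v‖ := norm_pos_iff.2 hv
  -- The orbit stays at a definite angle from v while the areas with v tend to zero, so the lifts
  -- themselves shrink. Two independent vectors cannot both shrink, as their area is preserved.
  have hlim : ∀ δ : Γ, Tendsto (fun n => ‖(a n).mulVec (δ • x).rep‖) atTop (𝓝 0) := by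
    intro δ
    have h1 : ∀ n, ‖‖(a n).mulVec (δ • x).rep‖‖ ≤
        |area v ((a n).mulVec (δ • x).rep)| / (κ * ‖v‖) := fun n => by
      rw [norm_norm, le_div_iff₀ (by positivity)]
      have hmem : (a n).mulVec (δ • x).rep ∈ coneOver (interior I)ᶜ := by
        refine ⟨(ha n).mulVec_ne_zero (δ • x).rep_nonzero, ?_⟩
        rw [← (ha n).smul_mk (δ • x).rep_nonzero, Projectivization.mk_rep]
        have := hx (g n * δ)
        rwa [mul_smul] at this
      linarith [hκb v ⟨hv, rfl⟩ _ hmem]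
    refine squeeze_zero_norm h1 ?_
    simpa using ((IsLift.tendsto_area ha ha0 (δ • x).rep).abs).div_const (κ * ‖v‖)
  have h1 : Tendsto (fun n => 2 * (‖(a n).mulVec (γ • x).rep‖ *
      ‖(a n).mulVec ((1 : Γ) • x).rep‖)) atTop (𝓝 0) := by
    simpa using ((hlim γ).mul (hlim 1)).const_mul 2
  have h2 : ∀ n, |area (γ • x).rep ((1 : Γ) • x).rep| ≤
      2 * (‖(a n).mulVec (γ • x).rep‖ * ‖(a n).mulVec ((1 : Γ) • x).rep‖) := fun n => by
    rw [← (ha n).abs_area_mulVec]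
    exact abs_area_le _ _
  have h3 : area (γ • x).rep ((1 : Γ) • x).rep = 0 :=
    abs_eq_zero.1 (le_antisymm (ge_of_tendsto' h1 h2) (abs_nonneg _))
  have h4 := (mk_eq_mk_iff_area (γ • x).rep_nonzero ((1 : Γ) • x).rep_nonzero).2 h3
  rw [Projectivization.mk_rep, Projectivization.mk_rep, one_smul] at h4
  exact hne h4

end IsNestingSystem

/-- A matrix of determinant one that fixes `u` is a transvection. -/
theorem exists_transvection {K : Matrix (Fin 2) (Fin 2) ℝ} (hK : K.det = 1) {u : Fin 2 → ℝ}
    (hu : u ≠ 0) (hKu : K.mulVec u = u) : ∃ s : ℝ, ∀ w, K.mulVec w = w + (s * area u w) • u := by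
  obtain ⟨w₀, hw₀⟩ := exists_area_eq_one hu
  refine ⟨area (K.mulVec w₀) w₀, fun w => ?_⟩
  have h1 : area u (K.mulVec w₀) = 1 := by
    have := area_mulVec K u w₀
    rwa [hKu, hK, one_mul, hw₀] at this
  have h2 := area_smul_eq u w₀ (K.mulVec w₀)
  rw [hw₀, h1, one_smul, one_smul] at h2
  have h3 := area_smul_eq u w₀ w
  rw [hw₀, one_smul] at h3
  have h4 := congrArg K.mulVec h3
  rw [Matrix.mulVec_add, Matrix.mulVec_smul, Matrix.mulVec_smul, hKu, h2] at h4
  rw [h4]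
  nth_rewrite 3 [h3]
  module

theorem IsLift.exists_eigenvalue {M : Matrix (Fin 2) (Fin 2) ℝ} {g : PGL(2, ℝ)} (hM : IsLift M g)
    {u : Fin 2 → ℝ} (hu : u ≠ 0)
    (h : g • Projectivization.mk ℝ u hu = Projectivization.mk ℝ u hu) :
    ∃ l : ℝ, l ≠ 0 ∧ M.mulVec u = l • u := by
  rw [hM.smul_mk, Projectivization.mk_eq_mk_iff'] at h
  obtain ⟨l, hl⟩ := h
  refine ⟨l, ?_, hl.symm⟩
  rintro rfl
  rw [zero_smul] at hl
  exact hM.mulVec_ne_zero hu hl.symm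

theorem IsLift.inv_mulVec_eigenvector {M : Matrix (Fin 2) (Fin 2) ℝ} {g : PGL(2, ℝ)}
    (hM : IsLift M g) {u : Fin 2 → ℝ} {l : ℝ} (hl : l ≠ 0) (h : M.mulVec u = l • u) :
    M⁻¹.mulVec u = l⁻¹ • u := by
  have := hM.inv_mulVec_mulVec u
  rw [h, Matrix.mulVec_smul] at this
  rw [← this, smul_smul, inv_mul_cancel₀ hl, one_smul, this]

/-- If a discrete group fixes `[u]` and contains elements that expand arbitrarily strongly at `[u]`
then commutators act trivially. -/
theorem commute_of_fixed_of_contracting (hΓ : DiscreteTopology Γ) {u : Fin 2 → ℝ} (hu : u ≠ 0)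
    (hfix : ∀ γ : Γ, γ • Projectivization.mk ℝ u hu = Projectivization.mk ℝ u hu) {g : ℕ → Γ}
    {a : ℕ → Matrix (Fin 2) (Fin 2) ℝ} (ha : ∀ n, IsLift (a n) (g n : PGL(2, ℝ)))
    (hau : Tendsto (fun n => (a n).mulVec u) atTop (𝓝 0)) (γ δ : Γ) (x : IdealCircle) :
    γ • δ • x = δ • γ • x := by
  obtain ⟨B, hB⟩ := exists_isLift (γ : PGL(2, ℝ))
  obtain ⟨C, hC⟩ := exists_isLift (δ : PGL(2, ℝ))
  obtain ⟨b, hb0, hb⟩ := hB.exists_eigenvalue hu (hfix γ)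
  obtain ⟨c, hc0, hc⟩ := hC.exists_eigenvalue hu (hfix δ)
  set K := B * C * B⁻¹ * C⁻¹ with hKdef
  have hK : IsLift K (γ * δ * γ⁻¹ * δ⁻¹ : Γ) := ((hB.mul hC).mul hB.inv).mul hC.inv
  have hKdet : K.det = 1 := by
    have := hB.det_ne_zero
    have := hC.det_ne_zero
    simp only [hKdef, Matrix.det_mul, Matrix.det_nonsing_inv, Ring.inverse_eq_inv']
    field_simp
  have hKu : K.mulVec u = u := by
    simp only [hKdef, ← Matrix.mulVec_mulVec]
    simp only [hC.inv_mulVec_eigenvector hc0 hc, hB.inv_mulVec_eigenvector hb0 hb, hb, hc,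
      Matrix.mulVec_smul, smul_smul]
    convert one_smul ℝ u
    field_simp
  obtain ⟨s, hs⟩ := exists_transvection hKdet hu hKu
  choose l hl0 hl using fun n => (ha n).exists_eigenvalue hu (hfix (g n))
  have hl_lim : Tendsto l atTop (𝓝 0) := by
    have h1 : Tendsto (fun n => ‖(a n).mulVec u‖ / ‖u‖) atTop (𝓝 0) := by
      simpa using hau.norm.div_const ‖u‖
    refine squeeze_zero_norm (fun n => ?_) h1
    rw [hl, norm_smul, mul_div_cancel_right₀ _ (norm_ne_zero_iff.2 hu)]
  -- Conjugation by a n rescales the parameter s of the transvection K by a factor that tends to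
  -- zero.
  have hconj : ∀ n w, (a n * K * (a n)⁻¹).mulVec w =
      w + (s * ((a n).det * l n ^ 2) * area u w) • u := by
    intro n w
    have h1 : area u ((a n)⁻¹.mulVec w) = (a n).det * l n * area u w := by
      have h2 := area_mulVec (a n) u ((a n)⁻¹.mulVec w)
      rw [(ha n).mulVec_inv_mulVec, hl, area_smul_left] at h2
      have := (ha n).det_mul_self
      linear_combination (-(a n).det) * h2 - area u ((a n)⁻¹.mulVec w) * this
    rw [← Matrix.mulVec_mulVec, ← Matrix.mulVec_mulVec, hs, Matrix.mulVec_add,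
      (ha n).mulVec_inv_mulVec, Matrix.mulVec_smul, hl, h1, smul_smul]
    congr 2
    ring
  set σ : ℕ → ℝ := fun n => s * ((a n).det * l n ^ 2) with hσ
  have hσ_lim : Tendsto σ atTop (𝓝 0) := by
    have h1 : Tendsto (fun n => |s| * l n ^ 2) atTop (𝓝 0) := by
      simpa using (hl_lim.pow 2).const_mul |s|
    refine squeeze_zero_norm (fun n => ?_) h1
    rw [hσ, Real.norm_eq_abs, abs_mul, abs_mul, (ha n).abs_det, one_mul, abs_of_nonneg (sq_nonneg (l n))]
  obtain ⟨w₀, hw₀⟩ := exists_area_eq_one hu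
  obtain ⟨R, hR⟩ : ∃ R, ∀ n, |σ n| ≤ R := by
    obtain ⟨R, hR⟩ := hσ_lim.abs.bddAbove_range
    exact ⟨R, fun n => hR ⟨n, rfl⟩⟩
  have hfin := finite_bounded_lifts hΓ (1 + R * 2 * ‖u‖ * ‖u‖)
  have hmem : ∀ n, g n * (γ * δ * γ⁻¹ * δ⁻¹) * (g n)⁻¹ ∈
      {γ : Γ | ∃ M, IsLift M (γ : PGL(2, ℝ)) ∧ ∀ i j, |M i j| ≤ 1 + R * 2 * ‖u‖ * ‖u‖} := by
    refine fun n => ⟨_, ((ha n).mul hK).mul (ha n).inv, fun i j =>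
      (abs_apply_le_norm_mulVec _ i j).trans ?_⟩
    have h1 : ‖(Pi.single j 1 : Fin 2 → ℝ)‖ = 1 := by rw [Pi.norm_single, norm_one]
    rw [hconj]
    refine (norm_add_le _ _).trans ?_
    rw [h1, norm_smul, Real.norm_eq_abs, abs_mul]
    have h2 := abs_area_le u (Pi.single j 1)
    rw [h1, mul_one] at h2
    have h3 := hR n
    have h4 : 0 ≤ R := (abs_nonneg _).trans h3
    calc 1 + |σ n| * |area u (Pi.single j 1)| * ‖u‖ ≤ 1 + R * (2 * ‖u‖) * ‖u‖ := by gcongr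
      _ = _ := by ring
  have hw₀n : w₀ ≠ 0 := by rintro rfl; simp [area] at hw₀
  have he : area u w₀ = 1 := hw₀
  have hact : ∀ n, (g n * (γ * δ * γ⁻¹ * δ⁻¹) * (g n)⁻¹) • Projectivization.mk ℝ w₀ hw₀n =
      affineChart he (σ n) := by
    intro n
    have h1 := (((ha n).mul hK).mul (ha n).inv).smul_mk hw₀n
    refine h1.trans ?_
    rw [affineChart, Projectivization.mk_eq_mk_iff']
    refine ⟨1, ?_⟩
    rw [one_smul, hconj, hw₀, mul_one, add_comm]
  have hσfin : (range σ).Finite := by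
    refine Set.Finite.of_finite_image (f := affineChart he) ?_ (affineChart_injective he).injOn
    refine (hfin.image fun γ : Γ => γ • Projectivization.mk ℝ w₀ hw₀n).subset ?_
    rintro _ ⟨_, ⟨n, rfl⟩, rfl⟩
    exact ⟨_, hmem n, hact n⟩
  -- By discreteness the rescaled parameters take finitely many values; tending to zero, they reach
  -- it.
  have hs0 : s = 0 := by
    have h1 : IsClosed (range σ \ {0}) := (hσfin.subset sdiff_subset).isClosed
    obtain ⟨n, hn⟩ := (hσ_lim.eventually (h1.isOpen_compl.mem_nhds (x := 0)
      (fun h0 => h0.2 rfl))).exists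
    have h2 : σ n = 0 := by
      by_contra hne
      exact hn ⟨⟨n, rfl⟩, hne⟩
    have h3 : (a n).det * l n ^ 2 ≠ 0 := mul_ne_zero (ha n).det_ne_zero (pow_ne_zero 2 (hl0 n))
    exact (mul_eq_zero.1 h2).resolve_right h3
  have htriv : ∀ x : IdealCircle, (γ * δ * γ⁻¹ * δ⁻¹) • x = x := by
    intro x
    induction x using Projectivization.ind with | h v hv =>
    refine (hK.smul_mk hv).trans ?_
    rw [Projectivization.mk_eq_mk_iff']
    exact ⟨1, by rw [hs, hs0]; simp⟩
  have := htriv (δ • γ • x)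
  rwa [mul_smul, mul_smul, mul_smul, inv_smul_smul, inv_smul_smul] at this

namespace IsNestingSystem

/-- Every orbit on the circle meets the interior of `I`. -/
theorem exists_smul_mem_interior (h : IsNestingSystem Γ I T) (hΓ : DiscreteTopology Γ)
    (x : IdealCircle) : ∃ γ : Γ, γ • x ∈ interior I := by
  by_contra! hx
  have hfix := h.smul_eq_of_orbit_avoids hΓ hx
  induction x using Projectivization.ind with | h u hu =>
  -- All of Γ fixes [u]. A sequence contracting towards y has eigenvalues at u tending to zero, so
  -- the actions of any two elements commute; it moves every q other than [u] to y, and commuting γ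
  -- past it shows that γ fixes y. This contradicts strict nesting.
  have hIfix : ∀ y ∈ I, ∀ γ : Γ, γ • y = y := by
    intro y hy γ
    by_cases hyx : y = Projectivization.mk ℝ u hu
    · rw [hyx]; exact hfix γ
    induction y using Projectivization.ind with | h v hv =>
    obtain ⟨g, a, ha, ha0⟩ := h.exists_contracting_sequence hΓ hv hy
    choose l hl0 hl using fun n => (ha n).exists_eigenvalue hu (hfix (g n))
    have harea : area v u ≠ 0 := fun h0 => hyx ((mk_eq_mk_iff_area hv hu).2 h0)
    have hau : Tendsto (fun n => (a n).mulVec u) atTop (𝓝 0) := by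
      have h1 := (IsLift.tendsto_area ha ha0 u).div_const (area v u)
      rw [zero_div] at h1
      have h2 : Tendsto l atTop (𝓝 0) := h1.congr fun n => by
        rw [hl, area_smul_right, mul_div_cancel_right₀ _ harea]
      simpa [hl] using h2.smul_const u
    have hcomm := commute_of_fixed_of_contracting hΓ hu hfix ha hau
    have hconv : ∀ q : IdealCircle, q ≠ Projectivization.mk ℝ u hu →
        Tendsto (fun n => g n • q) atTop (𝓝 (Projectivization.mk ℝ v hv)) := by
      intro q hq
      induction q using Projectivization.ind with | h w hw =>
      have hwu : 0 < |area w u| := abs_pos.2 fun h0 => hq ((mk_eq_mk_iff_area hw hu).2 h0)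
      refine (tendsto_mk_of_tendsto_area (fun n => (ha n).mulVec_ne_zero hw)
        (c := |area w u| / 2) (by positivity) ?_ hv (IsLift.tendsto_area ha ha0 w)).congr
        fun n => ((ha n).smul_mk hw).symm
      have h1 : Tendsto (fun n => ‖(a n).mulVec u‖) atTop (𝓝 0) := by simpa using hau.norm
      filter_upwards [h1.eventually (gt_mem_nhds one_pos)] with n hn
      have h2 := abs_area_le ((a n).mulVec w) ((a n).mulVec u)
      rw [(ha n).abs_area_mulVec] at h2
      nlinarith [norm_nonneg ((a n).mulVec w)]
    obtain ⟨q, hq⟩ : ∃ q, q ≠ Projectivization.mk ℝ u hu := ⟨_, hyx⟩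
    have h1 : Tendsto (fun n => γ • g n • q) atTop (𝓝 (γ • Projectivization.mk ℝ v hv)) :=
      (continuous_const_smul (γ : PGL(2, ℝ))).continuousAt.tendsto.comp (hconv q hq)
    have hγq : γ • q ≠ Projectivization.mk ℝ u hu := fun h0 => hq <| by
      rw [← hfix γ] at h0
      exact MulAction.injective γ h0
    refine tendsto_nhds_unique h1 ((hconv _ hγq).congr fun n => ?_)
    exact hcomm _ _ _
  obtain ⟨y, hy⟩ := h.interval.isConnected.nonempty
  rw [← h.cover, mem_iUnion₂] at hy
  obtain ⟨t, ht, -⟩ := hy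
  exact (h.ssubset t ht).2 fun z hz => ⟨z, hz, hIfix z hz t⟩

end IsNestingSystem

end Minimality

/-! ### The equivariant limit map -/

section BoundaryMap

variable {Γ : Subgroup PGL(2, ℝ)} {I : Set IdealCircle} {T : Set Γ}
  {ρ : Γ →* Matrix.SpecialLinearGroup (Fin 3) ℝ} {A : Set RP2} {N : ℕ} {tbar : Γ}

theorem smul_codedPoint_eq_of_codes (h : IsNestingSystem Γ I T) (hΓ : DiscreteTopology Γ)
    (hA : ContractingSystem T ρ A N tbar) {t s : ℕ → T} {γ : Γ} {x : IdealCircle}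
    (ht : Codes I t x) (hs : Codes I s (γ • x)) :
    ρ γ • hA.codedPoint t = hA.codedPoint s := by
  obtain ⟨F, hF, n, m, hn, hm, hmem⟩ := h.exists_shadowing hΓ ht hs
  exact hA.smul_codedPoint_eq hF hn hm hmem

/-- The n-th condition involves only n letters, so it is locally constant in the word and closed in
the point. -/
theorem isClosed_setOf_codes [TopologicalSpace T] [DiscreteTopology T] (hI : IsClosed I) :
    IsClosed {p : (ℕ → T) × I | Codes I p.1 (p.2 : IdealCircle)} := by
  have : {p : (ℕ → T) × I | Codes I p.1 (p.2 : IdealCircle)} =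
      ⋂ n, {p | (p.2 : IdealCircle) ∈ prefixProd (fun i => (p.1 i : Γ)) n • I} := by
    ext p; simp [Codes]
  rw [this]
  refine isClosed_iInter fun n => ?_
  have hloc : IsLocallyConstant fun p : (ℕ → T) × I => fun i : Fin n => p.1 i :=
    (IsLocallyConstant.iff_continuous _).2 (by fun_prop)
  rw [← isOpen_compl_iff, isOpen_iff_mem_nhds]
  intro p hp
  have h1 : ∀ᶠ q : (ℕ → T) × I in 𝓝 p, (fun i : Fin n => q.1 i) = fun i : Fin n => p.1 i :=
    hloc.eventually_eq p
  have h2 : ∀ᶠ q : (ℕ → T) × I in 𝓝 p,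
      (q.2 : IdealCircle) ∈ (prefixProd (fun i => (p.1 i : Γ)) n • I)ᶜ := by
    have hc : IsClosed (prefixProd (fun i => (p.1 i : Γ)) n • I) :=
      hI.smul ((prefixProd (fun i => (p.1 i : Γ)) n : Γ) : PGL(2, ℝ))
    exact (continuous_subtype_val.comp continuous_snd).continuousAt.eventually
      (hc.isOpen_compl.mem_nhds hp)
  filter_upwards [h1, h2] with q hq1 hq2 hq3
  refine hq2 ?_
  rwa [prefixProd_congr (s := fun i => (q.1 i : Γ)) fun i hi =>
    congrArg Subtype.val (congrFun hq1 ⟨i, hi⟩).symm]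

/-- The limit map on the interval. -/
theorem exists_limitMap_on_interval (h : IsNestingSystem Γ I T) (hΓ : DiscreteTopology Γ)
    (hA : ContractingSystem T ρ A N tbar) : ∃ ξ : I → RP2, Continuous ξ ∧ (∀ x, ξ x ∈ A) ∧
      ∀ (γ : Γ) (x y : I), γ • (x : IdealCircle) = y → ρ γ • ξ x = ξ y := by
  choose τ hτ using fun x : I => h.exists_codes x.2
  let _ : TopologicalSpace T := ⊥
  have : DiscreteTopology T := ⟨rfl⟩
  have : Finite T := h.finite
  have : CompactSpace I := isCompact_iff_compactSpace.1 h.interval.isClosed.isCompact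
  refine ⟨fun x => hA.codedPoint (τ x), ?_, fun x => hA.codedPoint_mem _, fun γ x y hxy =>
    smul_codedPoint_eq_of_codes h hΓ hA (hτ x) (hxy ▸ hτ y)⟩
  -- I is a quotient of the compact space R of coded points, on which the coded point is continuous;
  -- it factors through I by independence of the coding.
  let R := {p : (ℕ → T) × I // Codes I p.1 (p.2 : IdealCircle)}
  have : CompactSpace R :=
    isCompact_iff_compactSpace.1 (isClosed_setOf_codes h.interval.isClosed).isCompact
  let π : R → I := fun p => p.1.2
  have hπ : Continuous π := continuous_snd.comp continuous_subtype_val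
  have hquot : IsQuotientMap π :=
    hπ.isClosedMap.isQuotientMap hπ fun x => ⟨⟨(τ x, x), hτ x⟩, rfl⟩
  rw [hquot.continuous_iff]
  refine (hA.continuous_codedPoint.comp (continuous_fst.comp continuous_subtype_val)).congr
    fun p => ?_
  have := smul_codedPoint_eq_of_codes h hΓ hA (γ := 1) p.2 (by rw [one_smul]; exact hτ (π p))
  rwa [map_one, one_smul] at this

theorem exists_equivariant_limitMap (h : IsNestingSystem Γ I T) (hΓ : DiscreteTopology Γ)
    (hA : ContractingSystem T ρ A N tbar) :
    ∃ ξ : IdealCircle → RP2, Continuous ξ ∧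
      (∀ (γ : Γ) (x : IdealCircle), ξ (γ • x) = ρ γ • ξ x) ∧ ξ '' I ⊆ A := by
  obtain ⟨ξ, hξc, hξA, hξ⟩ := exists_limitMap_on_interval h hΓ hA
  choose δ hδ using h.exists_smul_mem_interior hΓ
  have hδI : ∀ x, δ x • x ∈ I := fun x => interior_subset (hδ x)
  -- Equivariance on I makes the choice of δ x irrelevant. As δ x takes x to the interior, the same
  -- element serves near x, which gives continuity.
  let Ξ : IdealCircle → RP2 := fun x => (ρ (δ x))⁻¹ • ξ ⟨δ x • x, hδI x⟩
  have key : ∀ (γ : Γ) (x : IdealCircle) (hx : γ • x ∈ I), Ξ x = (ρ γ)⁻¹ • ξ ⟨γ • x, hx⟩ := by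
    intro γ x hx
    have h1 := hξ (δ x * γ⁻¹) ⟨γ • x, hx⟩ ⟨δ x • x, hδI x⟩ (by simp [smul_smul])
    simp only [Ξ, ← h1, map_mul, map_inv, smul_smul, inv_mul_cancel_left]
  refine ⟨Ξ, ?_, fun γ x => ?_, ?_⟩
  · rw [continuous_iff_continuousAt]
    intro x
    have hcont : Continuous fun y : IdealCircle => δ x • y :=
      continuous_const_smul (δ x : PGL(2, ℝ))
    have hopen : IsOpen ((fun y : IdealCircle => δ x • y) ⁻¹' interior I) :=
      isOpen_interior.preimage hcont
    refine ContinuousOn.continuousAt (s := (fun y : IdealCircle => δ x • y) ⁻¹' interior I) ?_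
      (hopen.mem_nhds (hδ x))
    rw [continuousOn_iff_continuous_domRestrict]
    have h1 : Continuous fun y : ((fun y : IdealCircle => δ x • y) ⁻¹' interior I : Set _) =>
        (ρ (δ x))⁻¹ • ξ ⟨δ x • y.1, interior_subset y.2⟩ :=
      (continuous_const_smul (ρ (δ x))⁻¹).comp
        (hξc.comp ((hcont.comp continuous_subtype_val).subtype_mk fun y => interior_subset y.2))
    exact h1.congr fun y => (key (δ x) y.1 (interior_subset y.2)).symm
  · rw [key (δ x * γ⁻¹) (γ • x) (by simpa [smul_smul] using hδI x), key (δ x) x (hδI x)]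
    simp only [map_mul, map_inv, mul_inv_rev, inv_inv, mul_smul, inv_smul_smul]
  · rintro _ ⟨x, hx, rfl⟩
    rw [key 1 x (by simpa using hx), map_one, inv_one, one_smul]
    exact hξA _

end BoundaryMap

theorem proposition4p1 (Γ : Subgroup PGL(2, ℝ)) (hΓ : IsCocompactFuchsian Γ)
    (I : Set IdealCircle) (T : Set Γ) (hIT : IsNestingSystem Γ I T)
    (ρ : Γ →* Matrix.SpecialLinearGroup (Fin 3) ℝ)
    (A : Set RP2) (hA_closed : IsClosed A) (hA_int : (interior A).Nonempty)
    (hA_chart : InAffineChart A)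
    (N : ℕ) (hN : 1 ≤ N) (tbar : Γ) (htbar : tbar ∈ T)
    (h_inv : ∀ t ∈ T, ρ t • A ⊆ A)
    (h_int : ∀ t : Fin N → Γ, (∀ i, t i ∈ T) → t ⟨N - 1, by omega⟩ ≠ tbar →
      (List.ofFn fun i => ρ (t i)).prod • A ⊆ interior A)
    (h_point : ∃ p : RP2, ⋂ i : ℕ, ρ (tbar ^ i) • A = {p}) :
    ∃ ξ : IdealCircle → RP2, Continuous ξ ∧ (∀ (γ : Γ) (x : IdealCircle), ξ (γ • x) = ρ γ • ξ x) ∧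
      ξ '' I ⊆ A := by

  have hA : ContractingSystem T ρ A N tbar :=
    { finite := hIT.finite
      isClosed := hA_closed
      interior_nonempty := hA_int
      chart := hA_chart
      inv := h_inv
      int := fun t ht htN => by
        rw [map_prefixProd_smul]
        exact h_int (fun i => t i) (fun i => ht i) htN
      point := h_point }
  exact exists_equivariant_limitMap hIT hΓ.discrete hA
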